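/- Fix $M\ge 2$ and priorities $\mathbb P=\{0,\dots,M\}$. **Diagrams.** Let $\mathsf{Syn}_M$ be the free prop (strict symmetric monoidal category) on two generating objects $\blacktriangleright,\blacktriangleleft$ and the generating morphisms $$\vee:\blacktriangleright\to\blacktriangleright\blacktriangleright,\quad \bot:\blacktriangleright\to\varepsilon,\quad \wedge:\blacktriangleright\to\blacktriangleright\blacktriangleright,\quad \top:\blacktriangleright\to\varepsilon,\quad \mu:\blacktriangleright\blacktriangleright\to\blacktriangleright,\quad \eta:\varepsilon\to\blacktriangleright,\quad \langle p\rangle:\blacktriangleright\to\blacktriangleright\ (p\in\mathbb P),$$ together with $\mathrm{cap}:\blacktriangleleft\blacktriangleright\to\varepsilon$ and $\mathrm{cup}:\varepsilon\to\blacktriangleright\blacktriangleleft$. (Here $\vee,\bot$ are Player 0 nodes with two, resp. no exits, and $\wedge,\top$ the same for Player 1.) A diagram is a morphism of $\mathsf{Syn}_M$; it is *acyclic* if it is composed without $\mathrm{cap}$ and $\mathrm{cup}$. A diagram is in *normal form* if it equals $d_0;d_1;d_2;d_3$, where, besides identities and wire crossings, $d_0$ uses only $\vee,\bot$, $d_1$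 only $\wedge,\top$, $d_2$ only the $\langle p\rangle$, and $d_3$ only $\mu,\eta$. **Semantics.** An open parity game $A:v\to w$ has entries (the letters $\blacktriangleright$ of $v$ and $\blacktriangleleft$ of $w$), exits (the letters $\blacktriangleleft$ of $v$ and $\blacktriangleright$ of $w$), a finite set $V$ of internal positions, $V_0\subseteq V$ (Player 0's positions; the rest are Player 1's), a labelling $V\to\mathbb P$, and a set of edges from entries and internal positions to internal positions and exits, with exactly one edge out of each entry and exactly one into each exit. A diagram $d:v\to w$ is interpreted as a game $[\![d]\!]:v\to w$: identities, crossings, cap and cup are wires without internal positions; every other generator is a single position to which all entries lead and which leads to all exits, owned by Player 0 for $\vee,\bot$ and by Player 1 otherwise, with priority $p$ for $\langle p\rangle$ and $0$ otherwise; the monoidal product is juxtaposition; composition hides the middle wires and makes each path through them an edge. Strategies may depend on the history of the play. A play that stops at an internal position is lost by its owner; an infinite play is won by Player 0 iff the greatest priority occurring infinitely often is even; a play that ends at an exit $o$ has outcome $(o,k)$, with $k$ the greatest priority seen ($0$ if there is none). The semantics of $A$ is the set of pairs $(T,i)$, with $i$ an entry and $T$ a set of pairs (exit, priority), such that Player 0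 has a strategy from $i$ for which every Player 1 strategy gives a play that is won by Player 0 or has its outcome in $T$. Write $A\simeq B$ if $A,B:v\to w$ have the same semantics. **Equations.** Let $=_{\mathrm{PGA}}$ be the smallest congruence on diagrams, for both compositions, such that (writing $1$ for the identity of $\blacktriangleright$ and $\sigma$ for the crossing of two $\blacktriangleright$-wires): - A: cap and cup satisfy the two yanking equations, and the closed loop is the empty diagram; - B: $(\mu,\eta)$ is a commutative monoid; $(\vee,\bot)$ and $(\wedge,\top)$ are cocommutative comonoids; for $(\delta,\epsilon)\in\{(\vee,\bot),(\wedge,\top)\}$: $\mu;\delta=(\delta\otimes\delta);(1\otimes\sigma\otimes1);(\mu\otimes\mu)$, $\mu;\epsilon=\epsilon\otimes\epsilon$, $\eta;\delta=\eta\otimes\eta$, $\eta;\epsilon=\mathrm{id}_\varepsilon$, $\delta;\mu=1$; and for $(\delta,\delta',\epsilon')\in\{(\vee,\wedge,\top),(\wedge,\vee,\bot)\}$: $\delta;(\delta'\otimes1)=\delta';(\delta\otimes\delta);(1\otimes\sigma\otimes1);(1\otimes1\otimes\mu)$ and $\delta;(\epsilon'\otimes1)=\epsilon';\eta$; - C: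 $(\langle k\rangle\otimes\langle k\rangle);\mu=\mu;\langle k\rangle$, $\eta;\langle k\rangle=\eta$, $\langle k\rangle;\langle l\rangle=\langle\max(k,l)\rangle$, $\langle0\rangle=1$; - D: $\langle k\rangle;\delta=\delta;(\langle k\rangle\otimes\langle k\rangle)$ and $\langle k\rangle;\epsilon=\epsilon$ for $(\delta,\epsilon)\in\{(\vee,\bot),(\wedge,\top)\}$; - E: the trace over the first wire (formed with cup and cap) of $\mu;\vee;(\wedge\otimes1);(\langle p\rangle\otimes1\otimes1)$ equals $\vee$ if $p$ is even and $\eta\otimes1$ if $p$ is odd. **Theorem.** Let $c,d:\blacktriangleright^m\to\blacktriangleright^n$ be two acyclic diagrams in normal form. If $[\![c]\!]\simeq[\![d]\!]$, then $c=_{\mathrm{PGA}}d$. -/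

import Mathlib

namespace ParityGame

/-- The two generating objects of the prop of diagrams: a wire directed to the right, a wire
directed to the left. Objects are words `List Dir`. -/
inductive Dir : Type
  | right
  | left

/-- The set of priorities `{0, ..., M}`. -/
abbrev Priority (M : ℕ) : Type := Fin (M + 1)

/-! ### Diagrams -/

/-- The generating morphisms. -/
inductive Gen (M : ℕ) : List Dir → List Dir → Type
  | player0 : Gen M [.right] [.right, .right]
  | lose0 : Gen M [.right] []
  | player1 : Gen M [.right] [.right, .right]
  | lose1 : Gen M [.right] []
  | merge : Gen M [.right, .right] [.right]
  | start : Gen M [] [.right]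
  | prio (p : Priority M) : Gen M [.right] [.right]
  | cap : Gen M [.left, .right] []
  | cup : Gen M [] [.right, .left]

/-- Terms for the morphisms of the free two-coloured prop on `Gen M`. The morphisms are the
classes of such terms modulo `StructEq` below. -/
inductive Diagram (M : ℕ) : List Dir → List Dir → Type
  | gen {v w : List Dir} (g : Gen M v w) : Diagram M v w
  | id (v : List Dir) : Diagram M v v
  | swap (v w : List Dir) : Diagram M (v ++ w) (w ++ v)
  | comp {u v w : List Dir} (c : Diagram M u v) (d : Diagram M v w) : Diagram M u w
  | tensor {v w v' w' : List Dir} (c : Diagram M v w) (d : Diagram M v' w') :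
      Diagram M (v ++ v') (w ++ w')

/-- The word made of `n` wires directed to the right. -/
abbrev rightWires (n : ℕ) : List Dir := List.replicate n Dir.right

namespace Diagram

variable {M : ℕ}

/-- `d.UsesOnly S`: `d` is composed of generators in `S`, identities and wire crossings. -/
def UsesOnly (S : ∀ ⦃v w : List Dir⦄, Gen M v w → Prop) :
    ∀ {v w : List Dir}, Diagram M v w → Prop
  | _, _, gen g => S g
  | _, _, id _ => True
  | _, _, swap _ _ => True
  | _, _, comp c d => c.UsesOnly S ∧ d.UsesOnly S
  | _, _, tensor c d => c.UsesOnly S ∧ d.UsesOnly S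

abbrev player0 : Diagram M [.right] [.right, .right] := gen .player0
abbrev lose0 : Diagram M [.right] [] := gen .lose0
abbrev player1 : Diagram M [.right] [.right, .right] := gen .player1
abbrev lose1 : Diagram M [.right] [] := gen .lose1
abbrev merge : Diagram M [.right, .right] [.right] := gen .merge
abbrev start : Diagram M [] [.right] := gen .start
abbrev prio (p : Priority M) : Diagram M [.right] [.right] := gen (.prio p)
abbrev cap : Diagram M [.left, .right] [] := gen .cap
abbrev cup : Diagram M [] [.right, .left] := gen .cup

/-- The identity on one wire directed to the right. -/
abbrev wire : Diagram M [.right] [.right] := id [.right]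

/-- The identity on one wire directed to the left. -/
abbrev wireOp : Diagram M [.left] [.left] := id [.left]

/-- The empty diagram. -/
abbrev empty : Diagram M [] [] := id []

/-- The crossing of two wires directed to the right. -/
abbrev sym : Diagram M [.right, .right] [.right, .right] := swap [.right] [.right]

/-- `id ⊗ sym ⊗ id` on four wires directed to the right. -/
abbrev midSym : Diagram M [.right, .right, .right, .right] [.right, .right, .right, .right] :=
  tensor (tensor wire sym) wire

/-- Transport of a diagram along equalities of words. -/
def retype {v w v' w' : List Dir} (d : Diagram M v w) (hv : v = v') (hw : w = w') :
    Diagram M v' w' :=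
  hv ▸ hw ▸ d

/-- The body of the loop in the parity axiom: merge the loop wire with the input, then let
Player 0 choose between the second exit and a Player 1 choice between the loop (through
priority `p`) and the first exit. -/
def parityBody (p : Priority M) : Diagram M [.right, .right] [.right, .right, .right] :=
  comp merge (comp player0 (comp (tensor player1 wire) (tensor (prio p) (id [.right, .right]))))

/-- The trace of `parityBody p` along its first wire: the left-hand side of the parity axiom. -/
def parityLoop (p : Priority M) : Diagram M [.right] [.right, .right] :=
  comp (v := [.right, .left, .right]) (tensor cup wire)
    (comp (v := [.left, .right, .right]) (tensor (swap [.right] [.left]) wire)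
      (comp (v := [.left, .right, .right, .right]) (tensor wireOp (parityBody p))
        (tensor cap (id [.right, .right]))))

end Diagram

/-! ### Equational theories -/

open Diagram

/-- Relations between diagrams. The types of the two sides are allowed to differ, because the prop
is strict: `(u ++ v) ++ w` and `u ++ (v ++ w)` are the same object, but only propositionally so.
All relations below only relate diagrams whose types are (propositionally) equal. -/
abbrev DiagramRel (M : ℕ) : Type :=
  ∀ ⦃v w v' w' : List Dir⦄, Diagram M v w → Diagram M v' w' → Prop

/-- The laws of strict symmetric monoidal categories. -/
inductive SMCLaw (M : ℕ) : DiagramRel M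
  | comp_assoc {u v w x : List Dir} (c : Diagram M u v) (d : Diagram M v w) (e : Diagram M w x) :
      SMCLaw M (comp (comp c d) e) (comp c (comp d e))
  | id_comp {v w : List Dir} (c : Diagram M v w) : SMCLaw M (comp (id v) c) c
  | comp_id {v w : List Dir} (c : Diagram M v w) : SMCLaw M (comp c (id w)) c
  | tensor_assoc {u u' v v' w w' : List Dir}
      (c : Diagram M u u') (d : Diagram M v v') (e : Diagram M w w') :
      SMCLaw M (tensor (tensor c d) e) (tensor c (tensor d e))
  | empty_tensor {v w : List Dir} (c : Diagram M v w) : SMCLaw M (tensor (id []) c) c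
  | tensor_empty {v w : List Dir} (c : Diagram M v w) : SMCLaw M (tensor c (id [])) c
  | interchange {u v w u' v' w' : List Dir} (c : Diagram M u v) (d : Diagram M v w)
      (c' : Diagram M u' v') (d' : Diagram M v' w') :
      SMCLaw M (tensor (comp c d) (comp c' d')) (comp (tensor c c') (tensor d d'))
  | id_tensor_id (v w : List Dir) : SMCLaw M (tensor (id v) (id w)) (id (v ++ w))
  | swap_natural {v w v' w' : List Dir} (c : Diagram M v w) (d : Diagram M v' w') :
      SMCLaw M (comp (tensor c d) (swap w w')) (comp (swap v v') (tensor d c))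
  | swap_swap (v w : List Dir) : SMCLaw M (comp (swap v w) (swap w v)) (id (v ++ w))
  | swap_hexagon (u v w : List Dir) :
      SMCLaw M (swap u (v ++ w))
        (comp (tensor (swap u v) (id w))
          ((tensor (id v) (swap u w)).retype (List.append_assoc v u w).symm
            (List.append_assoc v w u).symm))

/-- The axioms of Parity Game Algebra. -/
inductive PGAAxiom (M : ℕ) : DiagramRel M
  -- compact closed structure and loop removal
  | A1 : PGAAxiom M (comp (v := [.right, .left, .right]) (tensor cup wire) (tensor wire cap)) wire
  | A2 : PGAAxiom M (comp (v := [.left, .right, .left]) (tensor wireOp cup) (tensor cap wireOp)) wireOp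
  | A3 : PGAAxiom M (comp cup (comp (swap [.right] [.left]) cap)) empty
  -- distributive lattices
  | B1 : PGAAxiom M (comp (tensor wire merge) merge) (comp (tensor merge wire) merge)
  | B2 : PGAAxiom M (comp sym merge) merge
  | B3r : PGAAxiom M (comp (tensor wire start) merge) wire
  | B3l : PGAAxiom M (comp (tensor start wire) merge) wire
  | B4 : PGAAxiom M (comp player0 (tensor player0 wire)) (comp player0 (tensor wire player0))
  | B5 : PGAAxiom M (comp player0 sym) player0
  | B6r : PGAAxiom M (comp player0 (tensor lose0 wire)) wire
  | B6l : PGAAxiom M (comp player0 (tensor wire lose0)) wire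
  | B7 : PGAAxiom M (comp player1 (tensor player1 wire)) (comp player1 (tensor wire player1))
  | B8 : PGAAxiom M (comp player1 sym) player1
  | B9r : PGAAxiom M (comp player1 (tensor lose1 wire)) wire
  | B9l : PGAAxiom M (comp player1 (tensor wire lose1)) wire
  | B10 : PGAAxiom M (comp merge player0)
      (comp (tensor player0 player0) (comp midSym (tensor merge merge)))
  | B11 : PGAAxiom M (comp merge lose0) (tensor lose0 lose0)
  | B12 : PGAAxiom M (comp start player0) (tensor start start)
  | B13 : PGAAxiom M (comp start player1) (tensor start start)
  | B14 : PGAAxiom M (comp start lose0) empty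
  | B15 : PGAAxiom M (comp start lose1) empty
  | B16 : PGAAxiom M (comp player0 merge) wire
  | B17 : PGAAxiom M (comp player1 merge) wire
  | B18 : PGAAxiom M (comp merge player1)
      (comp (tensor player1 player1) (comp midSym (tensor merge merge)))
  | B19 : PGAAxiom M (comp merge lose1) (tensor lose1 lose1)
  | B20 : PGAAxiom M (comp player0 (tensor player1 wire))
      (comp player1 (comp (tensor player0 player0) (comp midSym (tensor (id [.right, .right]) merge))))
  | B21 : PGAAxiom M (comp player0 (tensor lose1 wire)) (comp lose1 start)
  | B22 : PGAAxiom M (comp player1 (tensor player0 wire))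
      (comp player0 (comp (tensor player1 player1) (comp midSym (tensor (id [.right, .right]) merge))))
  | B23 : PGAAxiom M (comp player1 (tensor lose0 wire)) (comp lose0 start)
  -- priorities
  | C1 (k : Priority M) : PGAAxiom M (comp (tensor (prio k) (prio k)) merge) (comp merge (prio k))
  | C2 (k : Priority M) : PGAAxiom M (comp start (prio k)) start
  | C3 (k l : Priority M) : PGAAxiom M (comp (prio k) (prio l)) (prio (max k l))
  | C4 : PGAAxiom M (prio 0) wire
  -- distributivity of priorities over lattices
  | D1 (k : Priority M) :
      PGAAxiom M (comp (prio k) player0) (comp player0 (tensor (prio k) (prio k)))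
  | D2 (k : Priority M) : PGAAxiom M (comp (prio k) lose0) lose0
  | D3 (k : Priority M) :
      PGAAxiom M (comp (prio k) player1) (comp player1 (tensor (prio k) (prio k)))
  | D4 (k : Priority M) : PGAAxiom M (comp (prio k) lose1) lose1
  -- parity
  | E_even (p : Priority M) (hp : Even p.val) : PGAAxiom M (parityLoop p) player0
  | E_odd (p : Priority M) (hp : Odd p.val) : PGAAxiom M (parityLoop p) (tensor start wire)

/-- The smallest congruence (with respect to both compositions) that contains `R`. -/
inductive Congruence {M : ℕ} (R : DiagramRel M) : DiagramRel M
  | of {v w v' w' : List Dir} {c : Diagram M v w} {d : Diagram M v' w'} (h : R c d) :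
      Congruence R c d
  | refl {v w : List Dir} (c : Diagram M v w) : Congruence R c c
  | symm {v w v' w' : List Dir} {c : Diagram M v w} {d : Diagram M v' w'}
      (h : Congruence R c d) : Congruence R d c
  | trans {v w v' w' v'' w'' : List Dir} {c : Diagram M v w} {d : Diagram M v' w'}
      {e : Diagram M v'' w''} (h : Congruence R c d) (h' : Congruence R d e) : Congruence R c e
  | comp {u v w u' v' w' : List Dir} {c : Diagram M u v} {d : Diagram M v w}
      {c' : Diagram M u' v'} {d' : Diagram M v' w'}
      (h : Congruence R c c') (h' : Congruence R d d') :
      Congruence R (comp c d) (comp c' d')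
  | tensor {v w x y v' w' x' y' : List Dir} {c : Diagram M v w} {d : Diagram M x y}
      {c' : Diagram M v' w'} {d' : Diagram M x' y'}
      (h : Congruence R c c') (h' : Congruence R d d') :
      Congruence R (tensor c d) (tensor c' d')

/-- Structural equivalence: equality of morphisms of the free prop. -/
def StructEq {M : ℕ} : DiagramRel M := Congruence (SMCLaw M)

/-- Provable equality in Parity Game Algebra. -/
def PGAEq {M : ℕ} : DiagramRel M :=
  Congruence fun _ _ _ _ c d => SMCLaw M c d ∨ PGAAxiom M c d

/-! ### Acyclic diagrams and normal forms -/

section Layers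

variable {M : ℕ}

inductive IsPlayer0Gen : ∀ ⦃v w : List Dir⦄, Gen M v w → Prop
  | player0 : IsPlayer0Gen .player0
  | lose0 : IsPlayer0Gen .lose0

inductive IsPlayer1Gen : ∀ ⦃v w : List Dir⦄, Gen M v w → Prop
  | player1 : IsPlayer1Gen .player1
  | lose1 : IsPlayer1Gen .lose1

inductive IsPriorityGen : ∀ ⦃v w : List Dir⦄, Gen M v w → Prop
  | prio (p : Priority M) : IsPriorityGen (.prio p)

inductive IsMergeGen : ∀ ⦃v w : List Dir⦄, Gen M v w → Prop
  | merge : IsMergeGen .merge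
  | start : IsMergeGen .start

/-- All the generators except the cap and the cup. -/
def IsAcyclicGen ⦃v w : List Dir⦄ (g : Gen M v w) : Prop :=
  IsPlayer0Gen g ∨ IsPlayer1Gen g ∨ IsPriorityGen g ∨ IsMergeGen g

/-- A diagram is acyclic if it is composed without caps and cups. (Every term that is structurally
equal to an acyclic one is acyclic.) -/
def Diagram.IsAcyclic {v w : List Dir} (d : Diagram M v w) : Prop :=
  d.UsesOnly IsAcyclicGen

/-- A diagram is in normal form if, as a morphism of the free prop, it factors into a layer of
`player0, lose0`, then `player1, lose1`, then `prio p`, then `merge, start`. -/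
def Diagram.IsNormalForm {v w : List Dir} (d : Diagram M v w) : Prop :=
  ∃ (x y z : List Dir) (d₀ : Diagram M v x) (d₁ : Diagram M x y) (d₂ : Diagram M y z)
    (d₃ : Diagram M z w),
    d₀.UsesOnly IsPlayer0Gen ∧ d₁.UsesOnly IsPlayer1Gen ∧ d₂.UsesOnly IsPriorityGen ∧
      d₃.UsesOnly IsMergeGen ∧ StructEq d (comp d₀ (comp d₁ (comp d₂ d₃)))

end Layers

/-! ### Open parity games -/

/-- The positions of the word `v` at which the letter is `a`. -/
abbrev Port (v : List Dir) (a : Dir) : Type := {k : Fin v.length // v.get k = a}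

namespace Port

variable {u v : List Dir} {a : Dir}

/-- The positions of `u`, as positions of `u ++ v`. -/
def inl (p : Port u a) : Port (u ++ v) a :=
  ⟨⟨p.1.val, by have := p.1.isLt; simp; omega⟩, by
    have h := p.2
    simp only [List.get_eq_getElem] at h ⊢
    rw [List.getElem_append_left p.1.isLt]
    exact h⟩

/-- The positions of `v`, as positions of `u ++ v`. -/
def inr (p : Port v a) : Port (u ++ v) a :=
  ⟨⟨u.length + p.1.val, by have := p.1.isLt; simp⟩, by
    have h := p.2
    simp only [List.get_eq_getElem] at h ⊢
    rw [List.getElem_append_right (by omega)]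
    simpa using h⟩

theorem inl_or_inr_bijective :
    Function.Bijective (Sum.elim inl inr : Port u a ⊕ Port v a → Port (u ++ v) a) := by
  constructor
  · rintro (⟨⟨p, hp⟩, hp'⟩ | ⟨⟨p, hp⟩, hp'⟩) (⟨⟨q, hq⟩, hq'⟩ | ⟨⟨q, hq⟩, hq'⟩) h <;>
      simp [inl, inr] at h ⊢ <;> omega
  · rintro ⟨⟨p, hp⟩, hp'⟩
    by_cases h : p < u.length
    · refine ⟨Sum.inl ⟨⟨p, h⟩, ?_⟩, rfl⟩
      simp only [List.get_eq_getElem] at hp' ⊢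
      rwa [List.getElem_append_left h] at hp'
    · refine ⟨Sum.inr ⟨⟨p - u.length, by simp at hp; omega⟩, ?_⟩, ?_⟩
      · simp only [List.get_eq_getElem] at hp' ⊢
        rwa [List.getElem_append_right (by omega)] at hp'
      · simp only [Sum.elim_inr, inr, Subtype.mk.injEq, Fin.mk.injEq]
        omega

/-- The positions of `u ++ v` are those of `u`, followed by those of `v`. -/
noncomputable def append (u v : List Dir) (a : Dir) : Port u a ⊕ Port v a ≃ Port (u ++ v) a :=
  Equiv.ofBijective _ inl_or_inr_bijective

/-- The block transposition of positions. -/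
noncomputable def swap (u v : List Dir) (a : Dir) : Port (u ++ v) a ≃ Port (v ++ u) a :=
  (append u v a).symm.trans ((Equiv.sumComm _ _).trans (append v u a))

end Port

/-- The entry positions (inputs) of a game of type `v → w`: the right-directed wires of `v` and the
left-directed wires of `w`. -/
abbrev Entry (v w : List Dir) : Type := Port v .right ⊕ Port w .left

/-- The exit positions (outputs) of a game of type `v → w`: the left-directed wires of `v` and the
right-directed wires of `w`. -/
abbrev Exit (v w : List Dir) : Type := Port v .left ⊕ Port w .right

/-- Open parity games. The interface on each side is a word of directed wires. -/
structure Game (M : ℕ) (v w : List Dir) where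
  /-- internal positions -/
  V : Type
  finite_V : Finite V
  /-- the positions of Player 0; the others belong to Player 1 -/
  V₀ : Set V
  /-- the edges -/
  E : Entry v w ⊕ V → V ⊕ Exit v w → Prop
  entry_unique : ∀ i : Entry v w, ∃! y, E (Sum.inl i) y
  exit_unique : ∀ o : Exit v w, ∃! x, E x (Sum.inr o)
  label : V → Priority M

/-! ### Operations on open parity games -/

/-- Given one-step links `J` between sources `S`, intermediate points `I` and targets `T`,
`Through J x t` says that there is a path from `x` to `t` all of whose intermediate points
are in `I`. -/
inductive Through {S I T : Type} (J : S ⊕ I → I ⊕ T → Prop) : S ⊕ I → T → Prop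
  | last {x : S ⊕ I} {t : T} (h : J x (Sum.inr t)) : Through J x t
  | step {x : S ⊕ I} {i : I} {t : T} (h : J x (Sum.inl i)) (h' : Through J (Sum.inr i) t) :
      Through J x t

namespace Through

variable {S I T : Type} {J : S ⊕ I → I ⊕ T → Prop}

theorem existsUnique [Finite I] {s : S} (h₁ : ∃! y, J (Sum.inl s) y)
    (h₂ : ∀ i, ∃! y, J (Sum.inr i) y) (h₃ : ∀ i, ∃! x, J x (Sum.inl i)) :
    ∃! t, Through J (Sum.inl s) t := by
  have huniq : ∀ x : S ⊕ I, (∃! y, J x y) → ∀ t, Through J x t → ∀ t', Through J x t' → t = t' := by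
    intro x hx t ht
    induction ht with
    | last h =>
      intro t' ht'
      cases ht' with
      | last h' => exact Sum.inr_injective (hx.unique h h')
      | step h' _ => exact absurd (hx.unique h h') (by simp)
    | step h _ ih =>
      intro t' ht'
      cases ht' with
      | last h' => exact absurd (hx.unique h h') (by simp)
      | step h' h'' =>
        have := Sum.inl_injective (hx.unique h h')
        subst this
        exact ih (h₂ _) t' h''
  have hex : ∃ t, Through J (Sum.inl s) t := by
    by_contra hno
    let Bad : Type := {i : I // ¬ ∃ t, Through J (Sum.inr i) t}
    have hnext : ∀ b : Bad, ∃ b' : Bad, J (Sum.inr b.1) (Sum.inl b'.1) := by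
      rintro ⟨i, hi⟩
      obtain ⟨y | t, hy, -⟩ := h₂ i
      · exact ⟨⟨y, fun ⟨t, ht⟩ => hi ⟨t, .step hy ht⟩⟩, hy⟩
      · exact absurd ⟨t, .last hy⟩ hi
    choose g hg using hnext
    have hinj : Function.Injective g := by
      intro a b hab
      have h1 := hg a
      have h2 := hg b
      rw [← hab] at h2
      exact Subtype.ext (Sum.inr_injective ((h₃ _).unique h1 h2))
    have hsurj : Function.Surjective g := Finite.surjective_of_injective hinj
    obtain ⟨y | t, hy, -⟩ := h₁
    · obtain ⟨b, hb⟩ := hsurj ⟨y, fun ⟨t, ht⟩ => hno ⟨t, .step hy ht⟩⟩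
      have h1 := hg b
      rw [hb] at h1
      exact absurd ((h₃ _).unique hy h1) (by simp)
    · exact hno ⟨t, .last hy⟩
  obtain ⟨t, ht⟩ := hex
  exact ⟨t, ht, fun t' ht' => huniq _ h₁ _ ht' _ ht⟩

theorem reverse {s : S} {t : T} (h : Through J (Sum.inl s) t) :
    Through (fun x y => J y.swap x.swap) (Sum.inl t) s := by
  have key : ∀ x, Through J x t →
      (∀ s' : S, x = Sum.inl s' → Through (fun x y => J y.swap x.swap) (Sum.inl t) s') ∧
      (∀ (i : I) (s' : S), x = Sum.inr i → Through (fun x y => J y.swap x.swap) (Sum.inr i) s' →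
        Through (fun x y => J y.swap x.swap) (Sum.inl t) s') := by
    clear h
    intro x hx
    induction hx with
    | last h =>
      refine ⟨?_, ?_⟩
      · rintro s' rfl; exact .last h
      · rintro i s' rfl h'; exact .step h h'
    | step h _ ih =>
      refine ⟨?_, ?_⟩
      · rintro s' rfl; exact ih.2 _ _ rfl (.last h)
      · rintro i s' rfl h'; exact ih.2 _ _ rfl (.step h h')
  exact (key _ h).1 _ rfl

theorem existsUnique_source [Finite I] {t : T} (h₁ : ∃! x, J x (Sum.inr t))
    (h₂ : ∀ i, ∃! y, J (Sum.inr i) y) (h₃ : ∀ i, ∃! x, J x (Sum.inl i)) :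
    ∃! s, Through J (Sum.inl s) t := by
  have hswap : ∀ {A B : Type} {P : A ⊕ B → Prop}, (∃! x, P x) → ∃! x : B ⊕ A, P x.swap := by
    rintro A B P ⟨x, hx, hu⟩
    refine ⟨x.swap, by simpa using hx, fun y hy => ?_⟩
    rw [← hu _ hy, Sum.swap_swap]
  obtain ⟨s, hs, hu⟩ := existsUnique (J := fun x y => J y.swap x.swap) (s := t)
    (hswap h₁) (fun i => hswap (h₃ i)) (fun i => hswap (h₂ i))
  refine ⟨s, by simpa using hs.reverse, fun s' hs' => hu _ hs'.reverse⟩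

end Through

namespace Game

variable {M : ℕ}

/-- The game with a single internal position, of Player 0 if `owner₀` and of Player 1 otherwise,
with priority `p`, to which all entries lead and which leads to all exits. -/
def single (v w : List Dir) (owner₀ : Prop) (p : Priority M) : Game M v w where
  V := Unit
  finite_V := inferInstance
  V₀ := {_x | owner₀}
  E
    | Sum.inl _, Sum.inl _ => True
    | Sum.inr _, Sum.inr _ => True
    | _, _ => False
  entry_unique i := ⟨Sum.inl (), trivial, by rintro (_ | _) h; exacts [rfl, h.elim]⟩
  exit_unique o := ⟨Sum.inr (), trivial, by rintro (_ | _) h; exacts [h.elim, rfl]⟩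
  label _ := p

/-- The game without internal positions, in which the edges match the entries with the exits. -/
def wires {v w : List Dir} (e : Entry v w ≃ Exit v w) : Game M v w where
  V := Empty
  finite_V := inferInstance
  V₀ := ∅
  E
    | Sum.inl i, Sum.inr o => e i = o
    | _, _ => False
  entry_unique i := ⟨Sum.inr (e i), rfl, by rintro (_ | _) h; exacts [h.elim, by rw [h]]⟩
  exit_unique o := ⟨Sum.inl (e.symm o), e.apply_symm_apply o, by
    rintro (_ | _) h
    · rw [← show e _ = o from h, e.symm_apply_apply]
    · exact h.elim⟩
  label := Empty.elim

/-- The identity game. -/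
def id (v : List Dir) : Game M v v := wires (Equiv.sumComm _ _)

/-- The swap game. -/
noncomputable def swap (v w : List Dir) : Game M (v ++ w) (w ++ v) :=
  wires ((Equiv.sumCongr (Port.swap v w .right) (Port.swap w v .left)).trans (Equiv.sumComm _ _))

section Comp

variable {u v w : List Dir}

/-- The wires in the middle of a composition: those from the first game to the second and
those from the second game to the first. -/
abbrev Mid (v : List Dir) : Type := Port v .right ⊕ Port v .left

/-- The sources of edges of the first game, inside the composition. -/
def srcFst {X : Type} (Y : Type) (w : List Dir) :
    Entry u v ⊕ X → (Entry u w ⊕ (X ⊕ Y)) ⊕ Mid v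
  | Sum.inl (Sum.inl p) => Sum.inl (Sum.inl (Sum.inl p))
  | Sum.inl (Sum.inr p) => Sum.inr (Sum.inr p)
  | Sum.inr x => Sum.inl (Sum.inr (Sum.inl x))

/-- The targets of edges of the first game, inside the composition. -/
def tgtFst {X : Type} (Y : Type) (w : List Dir) :
    X ⊕ Exit u v → Mid v ⊕ ((X ⊕ Y) ⊕ Exit u w)
  | Sum.inl x => Sum.inr (Sum.inl (Sum.inl x))
  | Sum.inr (Sum.inl p) => Sum.inr (Sum.inr (Sum.inl p))
  | Sum.inr (Sum.inr p) => Sum.inl (Sum.inl p)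

/-- The sources of edges of the second game, inside the composition. -/
def srcSnd {Y : Type} (X : Type) (u : List Dir) :
    Entry v w ⊕ Y → (Entry u w ⊕ (X ⊕ Y)) ⊕ Mid v
  | Sum.inl (Sum.inl p) => Sum.inr (Sum.inl p)
  | Sum.inl (Sum.inr p) => Sum.inl (Sum.inl (Sum.inr p))
  | Sum.inr y => Sum.inl (Sum.inr (Sum.inr y))

/-- The targets of edges of the second game, inside the composition. -/
def tgtSnd {Y : Type} (X : Type) (u : List Dir) :
    Y ⊕ Exit v w → Mid v ⊕ ((X ⊕ Y) ⊕ Exit u w)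
  | Sum.inl y => Sum.inr (Sum.inl (Sum.inr y))
  | Sum.inr (Sum.inl p) => Sum.inl (Sum.inr p)
  | Sum.inr (Sum.inr p) => Sum.inr (Sum.inr (Sum.inr p))

/-- The edges of the two games, glued along the middle wires. -/
inductive Glue (A : Game M u v) (B : Game M v w) :
    (Entry u w ⊕ (A.V ⊕ B.V)) ⊕ Mid v → Mid v ⊕ ((A.V ⊕ B.V) ⊕ Exit u w) → Prop
  | fst {x y} (h : A.E x y) : Glue A B (srcFst B.V w x) (tgtFst B.V w y)
  | snd {x y} (h : B.E x y) : Glue A B (srcSnd A.V u x) (tgtSnd A.V u y)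

theorem glue_entry (A : Game M u v) (B : Game M v w) (i : Entry u w) :
    ∃! y, Glue A B (Sum.inl (Sum.inl i)) y := by
  rcases i with p | p
  · obtain ⟨y, hy, hu⟩ := A.entry_unique (Sum.inl p)
    refine ⟨tgtFst B.V w y, Glue.fst (x := Sum.inl (Sum.inl p)) hy, fun z hz => ?_⟩
    generalize hs : (Sum.inl (Sum.inl (Sum.inl p)) : (Entry u w ⊕ (A.V ⊕ B.V)) ⊕ Mid v) = s at hz
    rcases hz with @⟨x, y', h⟩ | @⟨x, y', h⟩ <;> rcases x with (x | x) | x <;>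
      simp [srcFst, srcSnd] at hs
    subst hs
    rw [hu _ h]
  · obtain ⟨y, hy, hu⟩ := B.entry_unique (Sum.inr p)
    refine ⟨tgtSnd A.V u y, Glue.snd (x := Sum.inl (Sum.inr p)) hy, fun z hz => ?_⟩
    generalize hs : (Sum.inl (Sum.inl (Sum.inr p)) : (Entry u w ⊕ (A.V ⊕ B.V)) ⊕ Mid v) = s at hz
    rcases hz with @⟨x, y', h⟩ | @⟨x, y', h⟩ <;> rcases x with (x | x) | x <;>
      simp [srcFst, srcSnd] at hs
    subst hs
    rw [hu _ h]

theorem glue_mid_out (A : Game M u v) (B : Game M v w) (m : Mid v) :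
    ∃! y, Glue A B (Sum.inr m) y := by
  rcases m with p | p
  · obtain ⟨y, hy, hu⟩ := B.entry_unique (Sum.inl p)
    refine ⟨tgtSnd A.V u y, Glue.snd (x := Sum.inl (Sum.inl p)) hy, fun z hz => ?_⟩
    generalize hs : (Sum.inr (Sum.inl p) : (Entry u w ⊕ (A.V ⊕ B.V)) ⊕ Mid v) = s at hz
    rcases hz with @⟨x, y', h⟩ | @⟨x, y', h⟩ <;> rcases x with (x | x) | x <;>
      simp [srcFst, srcSnd] at hs
    subst hs
    rw [hu _ h]
  · obtain ⟨y, hy, hu⟩ := A.entry_unique (Sum.inr p)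
    refine ⟨tgtFst B.V w y, Glue.fst (x := Sum.inl (Sum.inr p)) hy, fun z hz => ?_⟩
    generalize hs : (Sum.inr (Sum.inr p) : (Entry u w ⊕ (A.V ⊕ B.V)) ⊕ Mid v) = s at hz
    rcases hz with @⟨x, y', h⟩ | @⟨x, y', h⟩ <;> rcases x with (x | x) | x <;>
      simp [srcFst, srcSnd] at hs
    subst hs
    rw [hu _ h]

theorem glue_mid_in (A : Game M u v) (B : Game M v w) (m : Mid v) :
    ∃! x, Glue A B x (Sum.inl m) := by
  rcases m with p | p
  · obtain ⟨x, hx, hu⟩ := A.exit_unique (Sum.inr p)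
    refine ⟨srcFst B.V w x, Glue.fst (y := Sum.inr (Sum.inr p)) hx, fun z hz => ?_⟩
    generalize hs : (Sum.inl (Sum.inl p) : Mid v ⊕ ((A.V ⊕ B.V) ⊕ Exit u w)) = s at hz
    rcases hz with @⟨x', y, h⟩ | @⟨x', y, h⟩ <;> rcases y with y | (y | y) <;>
      simp [tgtFst, tgtSnd] at hs
    subst hs
    rw [hu _ h]
  · obtain ⟨x, hx, hu⟩ := B.exit_unique (Sum.inl p)
    refine ⟨srcSnd A.V u x, Glue.snd (y := Sum.inr (Sum.inl p)) hx, fun z hz => ?_⟩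
    generalize hs : (Sum.inl (Sum.inr p) : Mid v ⊕ ((A.V ⊕ B.V) ⊕ Exit u w)) = s at hz
    rcases hz with @⟨x', y, h⟩ | @⟨x', y, h⟩ <;> rcases y with y | (y | y) <;>
      simp [tgtFst, tgtSnd] at hs
    subst hs
    rw [hu _ h]

theorem glue_exit (A : Game M u v) (B : Game M v w) (o : Exit u w) :
    ∃! x, Glue A B x (Sum.inr (Sum.inr o)) := by
  rcases o with p | p
  · obtain ⟨x, hx, hu⟩ := A.exit_unique (Sum.inl p)
    refine ⟨srcFst B.V w x, Glue.fst (y := Sum.inr (Sum.inl p)) hx, fun z hz => ?_⟩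
    generalize hs : (Sum.inr (Sum.inr (Sum.inl p)) : Mid v ⊕ ((A.V ⊕ B.V) ⊕ Exit u w)) = s at hz
    rcases hz with @⟨x', y, h⟩ | @⟨x', y, h⟩ <;> rcases y with y | (y | y) <;>
      simp [tgtFst, tgtSnd] at hs
    subst hs
    rw [hu _ h]
  · obtain ⟨x, hx, hu⟩ := B.exit_unique (Sum.inr p)
    refine ⟨srcSnd A.V u x, Glue.snd (y := Sum.inr (Sum.inr p)) hx, fun z hz => ?_⟩
    generalize hs : (Sum.inr (Sum.inr (Sum.inr p)) : Mid v ⊕ ((A.V ⊕ B.V) ⊕ Exit u w)) = s at hz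
    rcases hz with @⟨x', y, h⟩ | @⟨x', y, h⟩ <;> rcases y with y | (y | y) <;>
      simp [tgtFst, tgtSnd] at hs
    subst hs
    rw [hu _ h]

/-- Composition: the middle wires are hidden, and each path through them becomes an edge. -/
def comp (A : Game M u v) (B : Game M v w) : Game M u w where
  V := A.V ⊕ B.V
  finite_V := by
    have := A.finite_V
    have := B.finite_V
    infer_instance
  V₀ := {x | Sum.elim (· ∈ A.V₀) (· ∈ B.V₀) x}
  E x y := Through (Glue A B) (Sum.inl x) y
  entry_unique i := Through.existsUnique (glue_entry A B i) (glue_mid_out A B) (glue_mid_in A B)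
  exit_unique o :=
    Through.existsUnique_source (glue_exit A B o) (glue_mid_out A B) (glue_mid_in A B)
  label := Sum.elim A.label B.label

end Comp

section Tensor

variable {v w v' w' : List Dir}

/-- The entries of a juxtaposition. -/
noncomputable def tensorEntry (v w v' w' : List Dir) :
    Entry v w ⊕ Entry v' w' ≃ Entry (v ++ v') (w ++ w') :=
  (Equiv.sumSumSumComm _ _ _ _).trans
    (Equiv.sumCongr (Port.append v v' .right) (Port.append w w' .left))

/-- The exits of a juxtaposition. -/
noncomputable def tensorExit (v w v' w' : List Dir) :
    Exit v w ⊕ Exit v' w' ≃ Exit (v ++ v') (w ++ w') :=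
  (Equiv.sumSumSumComm _ _ _ _).trans
    (Equiv.sumCongr (Port.append v v' .left) (Port.append w w' .right))

/-- The edges of a juxtaposition: those of both games, with renumbered entries and exits. -/
inductive TensorEdge (A : Game M v w) (B : Game M v' w') :
    Entry (v ++ v') (w ++ w') ⊕ (A.V ⊕ B.V) → (A.V ⊕ B.V) ⊕ Exit (v ++ v') (w ++ w') → Prop
  | fst {x y} (h : A.E x y) :
      TensorEdge A B (Sum.map (fun i => tensorEntry v w v' w' (Sum.inl i)) Sum.inl x)
        (Sum.map Sum.inl (fun o => tensorExit v w v' w' (Sum.inl o)) y)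
  | snd {x y} (h : B.E x y) :
      TensorEdge A B (Sum.map (fun i => tensorEntry v w v' w' (Sum.inr i)) Sum.inr x)
        (Sum.map Sum.inr (fun o => tensorExit v w v' w' (Sum.inr o)) y)

theorem tensorEdge_entry (A : Game M v w) (B : Game M v' w') (i : Entry (v ++ v') (w ++ w')) :
    ∃! y, TensorEdge A B (Sum.inl i) y := by
  obtain ⟨j, rfl⟩ := (tensorEntry v w v' w').surjective i
  rcases j with j | j
  · obtain ⟨y, hy, hu⟩ := A.entry_unique j
    refine ⟨_, TensorEdge.fst hy, fun z hz => ?_⟩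
    generalize hs : (Sum.inl (tensorEntry v w v' w' (Sum.inl j)) :
      Entry (v ++ v') (w ++ w') ⊕ (A.V ⊕ B.V)) = s at hz
    rcases hz with @⟨x, y', h⟩ | @⟨x, y', h⟩ <;> rcases x with x | x <;> simp at hs
    subst hs
    rw [hu _ h]
  · obtain ⟨y, hy, hu⟩ := B.entry_unique j
    refine ⟨_, TensorEdge.snd hy, fun z hz => ?_⟩
    generalize hs : (Sum.inl (tensorEntry v w v' w' (Sum.inr j)) :
      Entry (v ++ v') (w ++ w') ⊕ (A.V ⊕ B.V)) = s at hz
    rcases hz with @⟨x, y', h⟩ | @⟨x, y', h⟩ <;> rcases x with x | x <;> simp at hs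
    subst hs
    rw [hu _ h]

theorem tensorEdge_exit (A : Game M v w) (B : Game M v' w') (o : Exit (v ++ v') (w ++ w')) :
    ∃! x, TensorEdge A B x (Sum.inr o) := by
  obtain ⟨j, rfl⟩ := (tensorExit v w v' w').surjective o
  rcases j with j | j
  · obtain ⟨x, hx, hu⟩ := A.exit_unique j
    refine ⟨_, TensorEdge.fst hx, fun z hz => ?_⟩
    generalize hs : (Sum.inr (tensorExit v w v' w' (Sum.inl j)) :
      (A.V ⊕ B.V) ⊕ Exit (v ++ v') (w ++ w')) = s at hz
    rcases hz with @⟨x', y, h⟩ | @⟨x', y, h⟩ <;> rcases y with y | y <;> simp at hs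
    subst hs
    rw [hu _ h]
  · obtain ⟨x, hx, hu⟩ := B.exit_unique j
    refine ⟨_, TensorEdge.snd hx, fun z hz => ?_⟩
    generalize hs : (Sum.inr (tensorExit v w v' w' (Sum.inr j)) :
      (A.V ⊕ B.V) ⊕ Exit (v ++ v') (w ++ w')) = s at hz
    rcases hz with @⟨x', y, h⟩ | @⟨x', y, h⟩ <;> rcases y with y | y <;> simp at hs
    subst hs
    rw [hu _ h]

/-- Monoidal product: juxtaposition. -/
noncomputable def tensor (A : Game M v w) (B : Game M v' w') : Game M (v ++ v') (w ++ w') where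
  V := A.V ⊕ B.V
  finite_V := by
    have := A.finite_V
    have := B.finite_V
    infer_instance
  V₀ := {x | Sum.elim (· ∈ A.V₀) (· ∈ B.V₀) x}
  E := TensorEdge A B
  entry_unique := tensorEdge_entry A B
  exit_unique := tensorEdge_exit A B
  label := Sum.elim A.label B.label

end Tensor

/-! ### Plays, strategies and the semantics of games -/

section Semantics

variable {v w : List Dir} (A : Game M v w)

/-- A strategy of the player who owns the positions `P`: from the past of the play and the current
position in `P`, it chooses the next position, along an edge. (At a position without outgoing edge
there is nothing to choose, and the play stops there.) -/
structure Strategy (P : Set A.V) where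
  next : List (Entry v w ⊕ A.V) → P → A.V ⊕ Exit v w
  next_edge : ∀ (h : List (Entry v w ⊕ A.V)) (x : P),
    (∃ y, A.E (Sum.inr x.1) y) → A.E (Sum.inr x.1) (next h x)

/-- A finite play, given by its last position and by the list of the previous ones. -/
structure Stage where
  past : List (Entry v w ⊕ A.V)
  current : (Entry v w ⊕ A.V) ⊕ Exit v w

/-- Extension of a finite play by moving to the target of an edge. -/
def Stage.move (h : List (Entry v w ⊕ A.V)) (x : Entry v w ⊕ A.V) (y : A.V ⊕ Exit v w) :
    Stage A :=
  ⟨h ++ [x], Sum.map Sum.inr _root_.id y⟩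

/-- The position to which the unique edge out of an entry position leads. -/
noncomputable def entryNext (i : Entry v w) : A.V ⊕ Exit v w := (A.entry_unique i).choose

open Classical in
/-- One more move of the play induced by two strategies; `none` if no move is possible. -/
noncomputable def nextStage (σ₀ : A.Strategy A.V₀) (σ₁ : A.Strategy A.V₀ᶜ) :
    Stage A → Option (Stage A)
  | ⟨_, Sum.inr _⟩ => none
  | ⟨h, Sum.inl (Sum.inl i)⟩ => some (Stage.move A h (Sum.inl i) (A.entryNext i))
  | ⟨h, Sum.inl (Sum.inr x)⟩ =>
    if ∃ y, A.E (Sum.inr x) y then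
      some (Stage.move A h (Sum.inr x)
        (if hx : x ∈ A.V₀ then σ₀.next h ⟨x, hx⟩ else σ₁.next h ⟨x, hx⟩))
    else none

/-- The play induced by two strategies from the entry position `i`, after `n` moves; `none` if it
has stopped before. -/
noncomputable def play (σ₀ : A.Strategy A.V₀) (σ₁ : A.Strategy A.V₀ᶜ) (i : Entry v w) :
    ℕ → Option (Stage A)
  | 0 => some ⟨[], Sum.inl (Sum.inl i)⟩
  | n + 1 => (play σ₀ σ₁ i n).bind (A.nextStage σ₀ σ₁)

/-- The maximum of the priorities of the internal positions in a list (`0` if there are none). -/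
def maxPriority : List (Entry v w ⊕ A.V) → Priority M
  | [] => 0
  | Sum.inl _ :: h => maxPriority h
  | Sum.inr x :: h => max (A.label x) (maxPriority h)

/-- The priority `p` occurs infinitely often in the play. -/
def OccursInfinitelyOften (σ₀ : A.Strategy A.V₀) (σ₁ : A.Strategy A.V₀ᶜ) (i : Entry v w)
    (p : Priority M) : Prop :=
  ∃ᶠ n in Filter.atTop, ∃ h x, A.play σ₀ σ₁ i n = some ⟨h, Sum.inl (Sum.inr x)⟩ ∧ A.label x = p

/-- The priority `p` is the greatest one that occurs infinitely often in the play. -/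
def IsLimsupPriority (σ₀ : A.Strategy A.V₀) (σ₁ : A.Strategy A.V₀ᶜ) (i : Entry v w)
    (p : Priority M) : Prop :=
  IsGreatest {q | A.OccursInfinitelyOften σ₀ σ₁ i q} p

/-- Denotations of plays: `top` if Player 0 wins, `bot` if Player 1 wins, and an exit position with
a priority if the play leaves the game. -/
inductive Denotation (M : ℕ) (v w : List Dir) : Type
  | exit (o : Exit v w) (k : Priority M)
  | top
  | bot

/-- `PlayDenotes A σ₀ σ₁ i t`: the play induced by `σ₀` and `σ₁` from `i` has denotation `t`. A play
that stops at an internal position is lost by the owner of that position. -/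
inductive PlayDenotes (σ₀ : A.Strategy A.V₀) (σ₁ : A.Strategy A.V₀ᶜ) (i : Entry v w) :
    Denotation M v w → Prop
  | exit {n : ℕ} {h : List (Entry v w ⊕ A.V)} {o : Exit v w}
      (hn : A.play σ₀ σ₁ i n = some ⟨h, Sum.inr o⟩) :
      PlayDenotes σ₀ σ₁ i (.exit o (A.maxPriority h))
  | stuck₀ {n : ℕ} {h : List (Entry v w ⊕ A.V)} {x : A.V}
      (hn : A.play σ₀ σ₁ i n = some ⟨h, Sum.inl (Sum.inr x)⟩)
      (hx : x ∈ A.V₀) (hstuck : ¬ ∃ y, A.E (Sum.inr x) y) : PlayDenotes σ₀ σ₁ i .bot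
  | stuck₁ {n : ℕ} {h : List (Entry v w ⊕ A.V)} {x : A.V}
      (hn : A.play σ₀ σ₁ i n = some ⟨h, Sum.inl (Sum.inr x)⟩)
      (hx : x ∉ A.V₀) (hstuck : ¬ ∃ y, A.E (Sum.inr x) y) : PlayDenotes σ₀ σ₁ i .top
  | even {p : Priority M} (hinf : ∀ n, A.play σ₀ σ₁ i n ≠ none)
      (hp : A.IsLimsupPriority σ₀ σ₁ i p) (heven : Even p.val) : PlayDenotes σ₀ σ₁ i .top
  | odd {p : Priority M} (hinf : ∀ n, A.play σ₀ σ₁ i n ≠ none)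
      (hp : A.IsLimsupPriority σ₀ σ₁ i p) (hodd : Odd p.val) : PlayDenotes σ₀ σ₁ i .bot

/-- The denotation of an entry position and a strategy of Player 0 is `lose`. -/
def IsLosing (i : Entry v w) (σ₀ : A.Strategy A.V₀) : Prop :=
  ∃ σ₁ : A.Strategy A.V₀ᶜ, A.PlayDenotes σ₀ σ₁ i .bot

/-- The denotation of an entry position and a strategy of Player 0 which is not losing. -/
def outcomes (i : Entry v w) (σ₀ : A.Strategy A.V₀) : Set (Exit v w × Priority M) :=
  {e | ∃ σ₁ : A.Strategy A.V₀ᶜ, A.PlayDenotes σ₀ σ₁ i (.exit e.1 e.2)}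

/-- The semantics of an open parity game. -/
def semantics : Set (Set (Exit v w × Priority M) × Entry v w) :=
  {x | ∃ σ₀ : A.Strategy A.V₀, ¬ A.IsLosing x.2 σ₀ ∧ A.outcomes x.2 σ₀ ⊆ x.1}

/-- Equivalence of open parity games. -/
def Equivalent (A B : Game M v w) : Prop := A.semantics = B.semantics

end Semantics

end Game

/-! ### Interpretation of diagrams -/

/-- The game without internal positions whose entries all lead to all exits, for types with exactly
one entry and exactly one exit: a bent wire. -/
def Game.bentWire {M : ℕ} (v w : List Dir) (hi : ∃! _i : Entry v w, True)
    (ho : ∃! _o : Exit v w, True) : Game M v w where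
  V := Empty
  finite_V := inferInstance
  V₀ := ∅
  E
    | Sum.inl _, Sum.inr _ => True
    | _, _ => False
  entry_unique _ := by
    obtain ⟨o, -, ho⟩ := ho
    refine ⟨Sum.inr o, trivial, ?_⟩
    rintro (y | y) h
    exacts [h.elim, by rw [ho y trivial]]
  exit_unique _ := by
    obtain ⟨i, -, hi⟩ := hi
    refine ⟨Sum.inl i, trivial, ?_⟩
    rintro (y | y) h
    exacts [by rw [hi y trivial], h.elim]
  label := Empty.elim

theorem cap_entry : ∃! _i : Entry [.left, .right] [], True := by
  refine ⟨Sum.inl ⟨1, rfl⟩, trivial, ?_⟩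
  rintro (⟨⟨_ | _ | k, hk⟩, h⟩ | ⟨k, hk⟩) -
  · cases h
  · rfl
  · simp at hk
  · exact k.elim0

theorem cap_exit : ∃! _o : Exit [.left, .right] [], True := by
  refine ⟨Sum.inl ⟨0, rfl⟩, trivial, ?_⟩
  rintro (⟨⟨_ | _ | k, hk⟩, h⟩ | ⟨k, hk⟩) -
  · rfl
  · cases h
  · simp at hk
  · exact k.elim0

theorem cup_entry : ∃! _i : Entry [] [.right, .left], True := by
  refine ⟨Sum.inr ⟨1, rfl⟩, trivial, ?_⟩
  rintro (⟨k, hk⟩ | ⟨⟨_ | _ | k, hk⟩, h⟩) -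
  · exact k.elim0
  · cases h
  · rfl
  · simp at hk

theorem cup_exit : ∃! _o : Exit [] [.right, .left], True := by
  refine ⟨Sum.inr ⟨0, rfl⟩, trivial, ?_⟩
  rintro (⟨k, hk⟩ | ⟨⟨_ | _ | k, hk⟩, h⟩) -
  · exact k.elim0
  · rfl
  · cases h
  · simp at hk

/-- The interpretation of the generators. -/
def Gen.toGame {M : ℕ} : ∀ {v w : List Dir}, Gen M v w → Game M v w
  | _, _, player0 => Game.single _ _ True 0
  | _, _, lose0 => Game.single _ _ True 0
  | _, _, player1 => Game.single _ _ False 0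
  | _, _, lose1 => Game.single _ _ False 0
  | _, _, merge => Game.single _ _ False 0
  | _, _, start => Game.single _ _ False 0
  | _, _, prio p => Game.single _ _ False p
  | _, _, cap => Game.bentWire _ _ cap_entry cap_exit
  | _, _, cup => Game.bentWire _ _ cup_entry cup_exit

/-- The interpretation of diagrams as open parity games. -/
noncomputable def Diagram.toGame {M : ℕ} : ∀ {v w : List Dir}, Diagram M v w → Game M v w
  | _, _, gen g => g.toGame
  | _, _, id v => Game.id v
  | _, _, swap v w => Game.swap v w
  | _, _, comp c d => c.toGame.comp d.toGame
  | _, _, tensor c d => c.toGame.tensor d.toGame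

end ParityGame

/-!
The homomorphisms from the one-wire monoid object to a commutative monoid object form, under
convolution with the two comonoids, a bounded distributive lattice on which the priorities act. As a
commutative monoid object, a word is the coproduct of its wires, so an acyclic diagram is determined
up to `PGAEq` by the lattice terms obtained by pulling back the coprojections of its exits along it.
By the prime ideal theorem two terms agree in every distributive lattice as soon as they agree for
all truth values; the action of the priorities is accommodated by replacing truth values with
predicates on priorities, where `k` acts by precomposition with `max k`. With these coefficients,
the value of a term at an entry says whether Player 0 can force a prescribed set of outcomes: the
game of an acyclic diagram has no infinite plays, so its winning positions are the unique solution
of the one-step equations, and these solutions are compatible with both compositions. Hence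
equivalent games yield equal terms.
-/

namespace ParityGame

open CategoryTheory MonoidalCategory
open scoped MonObj

/-! ### The category of words and diagrams modulo provable equality -/

section Word

variable {M : ℕ}

theorem Congruence.words_eq {R : DiagramRel M}
    (hR : ∀ ⦃v w v' w' : List Dir⦄ {c : Diagram M v w} {d : Diagram M v' w'}, R c d →
      v = v' ∧ w = w')
    {v w v' w' : List Dir} {c : Diagram M v w} {d : Diagram M v' w'} (h : Congruence R c d) :
    v = v' ∧ w = w' := by
  induction h with
  | of h => exact hR h
  | refl => exact ⟨rfl, rfl⟩
  | symm _ ih => exact ⟨ih.1.symm, ih.2.symm⟩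
  | trans _ _ ih ih' => exact ⟨ih.1.trans ih'.1, ih.2.trans ih'.2⟩
  | comp _ _ ih ih' => exact ⟨ih.1, ih'.2⟩
  | tensor _ _ ih ih' => exact ⟨by rw [ih.1, ih'.1], by rw [ih.2, ih'.2]⟩

namespace PGAEq

variable {u v w x u' v' w' x' v'' w'' : List Dir}

theorem refl (c : Diagram M v w) : PGAEq c c := Congruence.refl c

theorem symm {c : Diagram M v w} {d : Diagram M v' w'} (h : PGAEq c d) : PGAEq d c :=
  Congruence.symm h

theorem trans {c : Diagram M v w} {d : Diagram M v' w'} {e : Diagram M v'' w''}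
    (h : PGAEq c d) (h' : PGAEq d e) : PGAEq c e :=
  Congruence.trans h h'

theorem comp {c : Diagram M u v} {d : Diagram M v w} {c' : Diagram M u' v'}
    {d' : Diagram M v' w'} (h : PGAEq c c') (h' : PGAEq d d') :
    PGAEq (Diagram.comp c d) (Diagram.comp c' d') :=
  Congruence.comp h h'

theorem tensor {c : Diagram M u v} {d : Diagram M w x} {c' : Diagram M u' v'}
    {d' : Diagram M w' x'} (h : PGAEq c c') (h' : PGAEq d d') :
    PGAEq (Diagram.tensor c d) (Diagram.tensor c' d') :=
  Congruence.tensor h h'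

theorem of_law {c : Diagram M v w} {d : Diagram M v' w'} (h : SMCLaw M c d) : PGAEq c d :=
  Congruence.of (Or.inl h)

theorem of_pgaAxiom {c : Diagram M v w} {d : Diagram M v' w'} (h : PGAAxiom M c d) : PGAEq c d :=
  Congruence.of (Or.inr h)

theorem words_eq {c : Diagram M v w} {d : Diagram M v' w'} (h : PGAEq c d) :
    v = v' ∧ w = w' := by
  refine Congruence.words_eq ?_ h
  rintro _ _ _ _ _ _ (h | h) <;> cases h <;> simp

theorem retype (c : Diagram M v w) (hv : v = v') (hw : w = w') : PGAEq (c.retype hv hw) c := by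
  subst hv hw
  exact refl c

theorem retype_id (h : v = v') (h' : v = w') :
    PGAEq ((Diagram.id (M := M) v).retype h h') (Diagram.id v) :=
  retype _ _ _

theorem id_congr (h : v = w) : PGAEq (Diagram.id (M := M) v) (Diagram.id w) := by
  subst h
  exact refl _

theorem comp_of_right_id {c : Diagram M u v} {d : Diagram M v w} {c' : Diagram M u' v'}
    (h : PGAEq c c') (h' : PGAEq d (Diagram.id x)) : PGAEq (Diagram.comp c d) c' :=
  ((refl c).comp (h'.trans (id_congr h'.words_eq.1.symm))).trans ((of_law (.comp_id c)).trans h)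

theorem comp_of_left_id {c : Diagram M u v} {d : Diagram M v w} {d' : Diagram M v' w'}
    (h : PGAEq c (Diagram.id x)) (h' : PGAEq d d') : PGAEq (Diagram.comp c d) d' :=
  ((h.trans (id_congr h.words_eq.2.symm)).comp (refl d)).trans ((of_law (.id_comp d)).trans h')

theorem tensor_of_id {c : Diagram M v v'} {d : Diagram M w w'} (h : PGAEq c (Diagram.id x))
    (h' : PGAEq d (Diagram.id x')) : PGAEq (Diagram.tensor c d) (Diagram.id (x ++ x')) :=
  (h.tensor h').trans (of_law (.id_tensor_id x x'))

end PGAEq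

/-- Words of wires, as the objects of the category of diagrams modulo `PGAEq`. -/
structure Word (M : ℕ) : Type where
  dirs : List Dir

namespace Word

instance pgaSetoid (v w : List Dir) : Setoid (Diagram M v w) where
  r c d := PGAEq c d
  iseqv := ⟨PGAEq.refl, PGAEq.symm, PGAEq.trans⟩

instance : CategoryStruct (Word M) where
  Hom v w := Quotient (pgaSetoid (M := M) v.dirs w.dirs)
  id v := Quotient.mk _ (Diagram.id v.dirs)
  comp := Quotient.map₂ Diagram.comp fun _ _ h _ _ h' => h.comp h'

/-- The class of a diagram modulo `PGAEq`, as a morphism between words. -/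
def homMk {v w : List Dir} (c : Diagram M v w) : (⟨v⟩ : Word M) ⟶ ⟨w⟩ := Quotient.mk _ c

theorem homMk_eq_iff {v w : List Dir} {c d : Diagram M v w} : homMk c = homMk d ↔ PGAEq c d :=
  Quotient.eq

theorem homMk_eq {v w : List Dir} {c d : Diagram M v w} (h : PGAEq c d) : homMk c = homMk d :=
  Quotient.sound h

theorem exists_homMk_eq {v w : Word M} (f : v ⟶ w) :
    ∃ c : Diagram M v.dirs w.dirs, homMk c = f :=
  Quotient.exists_rep f

theorem homMk_comp {u v w : List Dir} (c : Diagram M u v) (d : Diagram M v w) :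
    homMk (c.comp d) = homMk c ≫ homMk d := rfl

instance : Category (Word M) where
  id_comp f := by
    obtain ⟨c, rfl⟩ := exists_homMk_eq f
    exact homMk_eq (.of_law (.id_comp c))
  comp_id f := by
    obtain ⟨c, rfl⟩ := exists_homMk_eq f
    exact homMk_eq (.of_law (.comp_id c))
  assoc f g h := by
    obtain ⟨c, rfl⟩ := exists_homMk_eq f
    obtain ⟨d, rfl⟩ := exists_homMk_eq g
    obtain ⟨e, rfl⟩ := exists_homMk_eq h
    exact homMk_eq (.of_law (.comp_assoc c d e))

/-- The isomorphism between two equal words. -/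
def isoOfEq {v w : List Dir} (h : v = w) : (⟨v⟩ : Word M) ≅ ⟨w⟩ where
  hom := homMk ((Diagram.id v).retype rfl h)
  inv := homMk ((Diagram.id w).retype rfl h.symm)
  hom_inv_id := homMk_eq <| .comp_of_right_id (.retype _ _ _) (.retype_id _ _)
  inv_hom_id := homMk_eq <| .comp_of_right_id (.retype _ _ _) (.retype_id _ _)

instance : MonoidalCategoryStruct (Word M) where
  tensorObj v w := ⟨v.dirs ++ w.dirs⟩
  whiskerLeft v _ _ := Quotient.map (Diagram.tensor (Diagram.id v.dirs))
    fun _ _ h => PGAEq.tensor (.refl _) h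
  whiskerRight f v := Quotient.map (fun c => Diagram.tensor c (Diagram.id v.dirs))
    (fun _ _ h => PGAEq.tensor h (.refl _)) f
  tensorHom := Quotient.map₂ Diagram.tensor fun _ _ h _ _ h' => PGAEq.tensor h h'
  tensorUnit := ⟨[]⟩
  associator u v w := isoOfEq (List.append_assoc u.dirs v.dirs w.dirs)
  leftUnitor v := isoOfEq (List.nil_append v.dirs)
  rightUnitor v := isoOfEq (List.append_nil v.dirs)

theorem homMk_tensor {v w v' w' : List Dir} (c : Diagram M v w) (d : Diagram M v' w') :
    homMk (c.tensor d) = homMk c ⊗ₘ homMk d := rfl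

instance : MonoidalCategory (Word M) where
  tensorHom_def f g := by
    obtain ⟨c, rfl⟩ := exists_homMk_eq f
    obtain ⟨d, rfl⟩ := exists_homMk_eq g
    exact homMk_eq <| .trans
      (.tensor (.symm (.of_law (.comp_id c))) (.symm (.of_law (.id_comp d))))
      (.of_law (.interchange c _ _ d))
  id_tensorHom_id v w := homMk_eq <| .of_law (.id_tensor_id v.dirs w.dirs)
  tensorHom_comp_tensorHom f g f' g' := by
    obtain ⟨c, rfl⟩ := exists_homMk_eq f
    obtain ⟨d, rfl⟩ := exists_homMk_eq g
    obtain ⟨c', rfl⟩ := exists_homMk_eq f'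
    obtain ⟨d', rfl⟩ := exists_homMk_eq g'
    exact homMk_eq <| .symm <| .of_law (.interchange c c' d d')
  whiskerLeft_id v w := homMk_eq <| .of_law (.id_tensor_id v.dirs w.dirs)
  id_whiskerRight v w := homMk_eq <| .of_law (.id_tensor_id v.dirs w.dirs)
  associator_naturality f g h := by
    obtain ⟨c, rfl⟩ := exists_homMk_eq f
    obtain ⟨d, rfl⟩ := exists_homMk_eq g
    obtain ⟨e, rfl⟩ := exists_homMk_eq h
    exact homMk_eq <| .trans
      (.comp_of_right_id (.of_law (.tensor_assoc c d e)) (.retype_id _ _))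
      (.symm (.comp_of_left_id (.retype_id _ _) (.refl _)))
  leftUnitor_naturality f := by
    obtain ⟨c, rfl⟩ := exists_homMk_eq f
    exact homMk_eq <| .trans (.comp_of_right_id (.of_law (.empty_tensor c)) (.retype_id _ _))
      (.symm (.comp_of_left_id (.retype_id _ _) (.refl _)))
  rightUnitor_naturality f := by
    obtain ⟨c, rfl⟩ := exists_homMk_eq f
    exact homMk_eq <| .trans (.comp_of_right_id (.of_law (.tensor_empty c)) (.retype_id _ _))
      (.symm (.comp_of_left_id (.retype_id _ _) (.refl _)))
  pentagon u v w x := homMk_eq <| .trans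
    (.comp_of_right_id (.tensor_of_id (.retype_id _ _) (.refl _))
      (PGAEq.comp_of_right_id (.retype_id _ _) (.tensor_of_id (.refl _) (.retype_id _ _))))
    (.symm (.comp_of_right_id
      ((PGAEq.retype_id _ _).trans (.id_congr (by simp only [tensorObj, List.append_assoc])))
      (.retype_id _ _)))
  triangle v w := homMk_eq <| .trans
    (.comp_of_right_id (.retype_id _ _) (.tensor_of_id (.refl _) (.retype_id _ _)))
    (.symm (.tensor_of_id (.retype_id _ _) (.refl _)))

/-- The crossing of two words, as the braiding of the category of words. -/
def crossing (v w : Word M) : v ⊗ w ≅ w ⊗ v where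
  hom := homMk (Diagram.swap v.dirs w.dirs)
  inv := homMk (Diagram.swap w.dirs v.dirs)
  hom_inv_id := homMk_eq <| .of_law (.swap_swap _ _)
  inv_hom_id := homMk_eq <| .of_law (.swap_swap _ _)

theorem crossing_natural {v w v' w' : Word M} (f : v ⟶ w) (g : v' ⟶ w') :
    (f ⊗ₘ g) ≫ (crossing w w').hom = (crossing v v').hom ≫ (g ⊗ₘ f) := by
  obtain ⟨c, rfl⟩ := exists_homMk_eq f
  obtain ⟨d, rfl⟩ := exists_homMk_eq g
  exact homMk_eq <| .of_law (.swap_natural c d)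

theorem hexagon (u v w : Word M) :
    (α_ u v w).hom ≫ (crossing u (v ⊗ w)).hom ≫ (α_ v w u).hom =
      ((crossing u v).hom ▷ w) ≫ (α_ v u w).hom ≫ (v ◁ (crossing u w).hom) :=
  homMk_eq <| .trans
    (.comp_of_left_id (.retype_id _ _)
      (.comp_of_right_id (.of_law (.swap_hexagon u.dirs v.dirs w.dirs)) (.retype_id _ _)))
    (.comp (.refl _)
      ((PGAEq.retype _ _ _).trans (.symm (.comp_of_left_id (.retype_id _ _) (.refl _)))))

instance : BraidedCategory (Word M) where
  braiding := crossing
  braiding_naturality_right v _ _ f := by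
    rw [← id_tensorHom, ← tensorHom_id, crossing_natural]
  braiding_naturality_left f w := by
    rw [← id_tensorHom, ← tensorHom_id, crossing_natural]
  hexagon_forward := hexagon
  hexagon_reverse u v w := by
    -- The inverse of a crossing is the opposite crossing.
    have h : α_ w u v ≪≫ (crossing w (u ⊗ v) ≪≫ α_ u v w) =
        whiskerRightIso (crossing w u) v ≪≫ (α_ u w v ≪≫ whiskerLeftIso u (crossing w v)) := by
      ext
      exact hexagon w u v
    have h_inv := congrArg Iso.inv h
    simp only [Iso.trans_inv, whiskerRightIso_inv, whiskerLeftIso_inv, Category.assoc] at h_inv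
    exact h_inv

instance : SymmetricCategory (Word M) where
  symmetry v w := (crossing v w).hom_inv_id

end Word

end Word

/-! ### Copairings and convolution in a braided monoidal category -/

section TensorDesc

variable {C : Type*} [Category C] [MonoidalCategory C]
variable {K : C} [MonObj K] {W X Y Z : C}

/-- The copairing of two morphisms to a monoid object. When `K` is commutative and `f`, `g` are
homomorphisms, this is the copairing of the coproduct `Y ⊗ Z` of commutative monoid objects. -/
def tensorDesc (f : Y ⟶ K) (g : Z ⟶ K) : Y ⊗ Z ⟶ K := (f ⊗ₘ g) ≫ μ[K]

theorem tensorHom_comp_tensorDesc {Y' Z' : C} (a : Y ⟶ Y') (b : Z ⟶ Z') (f : Y' ⟶ K)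
    (g : Z' ⟶ K) : (a ⊗ₘ b) ≫ tensorDesc f g = tensorDesc (a ≫ f) (b ≫ g) := by
  simp only [tensorDesc, tensorHom_comp_tensorHom_assoc]

theorem whiskerRight_comp_tensorDesc {Y' : C} (a : Y ⟶ Y') (f : Y' ⟶ K) (g : Z ⟶ K) :
    a ▷ Z ≫ tensorDesc f g = tensorDesc (a ≫ f) g := by
  rw [← tensorHom_id, tensorHom_comp_tensorDesc, Category.id_comp]

theorem whiskerLeft_comp_tensorDesc {Z' : C} (b : Z ⟶ Z') (f : Y ⟶ K) (g : Z' ⟶ K) :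
    Y ◁ b ≫ tensorDesc f g = tensorDesc f (b ≫ g) := by
  rw [← id_tensorHom, tensorHom_comp_tensorDesc, Category.id_comp]

theorem tensorDesc_one (f : Y ⟶ K) : tensorDesc f η[K] = (ρ_ Y).hom ≫ f :=
  MonObj.mul_one_hom f

theorem one_tensorDesc (f : Y ⟶ K) : tensorDesc η[K] f = (λ_ Y).hom ≫ f :=
  MonObj.one_mul_hom f

theorem associator_comp_tensorDesc (f : Y ⟶ K) (g : Z ⟶ K) (h : W ⟶ K) :
    (α_ Y Z W).hom ≫ tensorDesc f (tensorDesc g h) = tensorDesc (tensorDesc f g) h := by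
  have h_right : tensorDesc f (tensorDesc g h) = (f ⊗ₘ g ⊗ₘ h) ≫ K ◁ μ[K] ≫ μ[K] := by
    simp only [tensorDesc, ← id_tensorHom, tensorHom_comp_tensorHom_assoc, Category.comp_id]
  have h_left : tensorDesc (tensorDesc f g) h = ((f ⊗ₘ g) ⊗ₘ h) ≫ μ[K] ▷ K ≫ μ[K] := by
    simp only [tensorDesc, ← tensorHom_id, tensorHom_comp_tensorHom_assoc, Category.comp_id]
  rw [h_right, h_left, MonObj.mul_assoc, associator_naturality_assoc]

theorem tensorDesc_comp {K' : C} [MonObj K'] (f : Y ⟶ K) (g : Z ⟶ K) (h : K ⟶ K') [IsMonHom h] :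
    tensorDesc f g ≫ h = tensorDesc (f ≫ h) (g ≫ h) := by
  simp only [tensorDesc, Category.assoc, IsMonHom.mul_hom, tensorHom_comp_tensorHom_assoc]

theorem mul_comp [MonObj X] (h : X ⟶ K) [IsMonHom h] : μ[X] ≫ h = tensorDesc h h :=
  IsMonHom.mul_hom h

instance isMonHom_one : IsMonHom η[K] where
  one_hom := by simp
  mul_hom := by simp [unitors_equal]

variable [BraidedCategory C]

theorem braiding_comp_tensorDesc [IsCommMonObj K] (f : Y ⟶ K) (g : Z ⟶ K) :
    (β_ Z Y).hom ≫ tensorDesc f g = tensorDesc g f := by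
  rw [tensorDesc, ← BraidedCategory.braiding_naturality_assoc, IsCommMonObj.mul_comm, tensorDesc]

theorem tensorμ_comp_tensorDesc [IsCommMonObj K] (f : W ⟶ K) (g : X ⟶ K) (h : Y ⟶ K)
    (k : Z ⟶ K) :
    tensorμ W X Y Z ≫ tensorDesc (tensorDesc f h) (tensorDesc g k) =
      tensorDesc (tensorDesc f g) (tensorDesc h k) := by
  simp only [tensorDesc, ← tensorHom_comp_tensorHom, Category.assoc]
  rw [← tensorμ_natural_assoc, MonObj.mul_mul_mul_comm]

theorem tensorμ_tensorUnit : tensorμ Y (𝟙_ C) (𝟙_ C) Z = 𝟙 _ := by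
  simp only [tensorμ, braiding_tensorUnit_left]
  monoidal

instance isMonHom_mul [IsCommMonObj K] : IsMonHom μ[K] where
  one_hom := by simp [MonObj.tensorObj.one_def, ← unitors_equal]
  mul_hom := by simp [MonObj.tensorObj.mul_def]

variable [MonObj Y] [MonObj Z]

instance isMonHom_tensorDesc [IsCommMonObj K] (f : Y ⟶ K) (g : Z ⟶ K) [IsMonHom f] [IsMonHom g] :
    IsMonHom (tensorDesc f g) :=
  inferInstanceAs (IsMonHom ((f ⊗ₘ g) ≫ μ[K]))

variable (Y Z) in
/-- The first coprojection to a tensor product of monoid objects. -/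
def tensorInl : Mon.mk Y ⟶ Mon.mk (Y ⊗ Z) := Mon.ofHom ((ρ_ Y).inv ≫ (𝟙 Y ⊗ₘ η[Z]))

variable (Y Z) in
/-- The second coprojection to a tensor product of monoid objects. -/
def tensorInr : Mon.mk Z ⟶ Mon.mk (Y ⊗ Z) := Mon.ofHom ((λ_ Z).inv ≫ (η[Y] ⊗ₘ 𝟙 Z))

theorem tensorDesc_inl_inr :
    tensorDesc (tensorInl Y Z).hom (tensorInr Y Z).hom = 𝟙 (Y ⊗ Z) := by
  change tensorDesc ((ρ_ Y).inv ≫ (𝟙 Y ⊗ₘ η[Z])) ((λ_ Z).inv ≫ (η[Y] ⊗ₘ 𝟙 Z)) = _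
  rw [← tensorHom_comp_tensorDesc, tensorDesc, MonObj.tensorObj.mul_def,
    tensorμ_natural_assoc, tensorHom_comp_tensorHom, MonObj.one_mul_hom, MonObj.mul_one_hom,
    tensorμ_tensorUnit, Category.id_comp, tensorHom_comp_tensorHom]
  simp only [Category.comp_id, Iso.inv_hom_id, id_tensorHom_id]

end TensorDesc

section Convolution

variable {C : Type*} [Category C] [MonoidalCategory C] [BraidedCategory C]
variable {X K : C} [MonObj X] [MonObj K]

/-- `δ` and `ε` make the monoid object `X` a cocommutative bimonoid. This is a predicate, and not
Mathlib's `BimonObj`, because a lattice object carries two such structures. -/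
structure IsCocommBimonoid (δ : X ⟶ X ⊗ X) (ε : X ⟶ 𝟙_ C) : Prop where
  isMonHom_comul : IsMonHom δ
  isMonHom_counit : IsMonHom ε
  comul_assoc : δ ≫ X ◁ δ = δ ≫ δ ▷ X ≫ (α_ X X X).hom
  comul_comm : δ ≫ (β_ X X).hom = δ
  counit_comul : δ ≫ ε ▷ X = (λ_ X).inv

/-- The comultiplication `δ` distributes over the comonoid `(δ', ε')`. -/
structure Distributes (δ δ' : X ⟶ X ⊗ X) (ε' : X ⟶ 𝟙_ C) : Prop where
  comul : δ ≫ δ' ▷ X = δ' ≫ (δ ⊗ₘ δ) ≫ tensorμ X X X X ≫ (X ⊗ X) ◁ μ[X]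
  counit : δ ≫ ε' ▷ X = ε' ≫ η[X] ≫ (λ_ X).inv

namespace IsCocommBimonoid

variable {δ : X ⟶ X ⊗ X} {ε : X ⟶ 𝟙_ C} (h : IsCocommBimonoid δ ε)
include h

theorem convolution_assoc (x y z : X ⟶ K) :
    δ ≫ tensorDesc (δ ≫ tensorDesc x y) z = δ ≫ tensorDesc x (δ ≫ tensorDesc y z) := by
  have h' := h.comul_assoc
  rw [← whiskerRight_comp_tensorDesc, ← whiskerLeft_comp_tensorDesc, reassoc_of% h',
    associator_comp_tensorDesc]

theorem convolution_comm [IsCommMonObj K] (x y : X ⟶ K) :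
    δ ≫ tensorDesc x y = δ ≫ tensorDesc y x := by
  have h' := h.comul_comm
  rw [← braiding_comp_tensorDesc, reassoc_of% h']

theorem unit_convolution (x : X ⟶ K) : δ ≫ tensorDesc (ε ≫ η[K]) x = x := by
  have h' := h.counit_comul
  rw [← whiskerRight_comp_tensorDesc, reassoc_of% h', one_tensorDesc, Iso.inv_hom_id_assoc]

end IsCocommBimonoid

namespace Distributes

variable {δ δ' : X ⟶ X ⊗ X} {ε' : X ⟶ 𝟙_ C} (h : Distributes δ δ' ε')
include h

theorem convolution_convolution [IsCommMonObj K] (x y z : X ⟶ K) [IsMonHom z] :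
    δ ≫ tensorDesc (δ' ≫ tensorDesc x y) z =
      δ' ≫ tensorDesc (δ ≫ tensorDesc x z) (δ ≫ tensorDesc y z) := by
  have h' := h.comul
  rw [← whiskerRight_comp_tensorDesc, reassoc_of% h', whiskerLeft_comp_tensorDesc, mul_comp,
    tensorμ_comp_tensorDesc, tensorHom_comp_tensorDesc]

theorem unit_convolution (z : X ⟶ K) [IsMonHom z] :
    δ ≫ tensorDesc (ε' ≫ η[K]) z = ε' ≫ η[K] := by
  have h' := h.counit
  rw [← whiskerRight_comp_tensorDesc, reassoc_of% h', one_tensorDesc, Iso.inv_hom_id_assoc,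
    IsMonHom.one_hom]

end Distributes

variable (X) in
/-- A monoid object whose homomorphisms to commutative monoid objects form a bounded distributive
lattice, under convolution, with an action of the priorities. -/
class LatticeObj (M : outParam ℕ) where
  join : X ⟶ X ⊗ X
  bot : X ⟶ 𝟙_ C
  meet : X ⟶ X ⊗ X
  top : X ⟶ 𝟙_ C
  prio : Priority M → (X ⟶ X)
  isCocommBimonoid_join : IsCocommBimonoid join bot
  isCocommBimonoid_meet : IsCocommBimonoid meet top
  distributes_join : Distributes join meet top
  distributes_meet : Distributes meet join bot
  isMonHom_prio (k : Priority M) : IsMonHom (prio k)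
  prio_prio (k l : Priority M) : prio k ≫ prio l = prio (max k l)
  prio_zero : prio 0 = 𝟙 X
  prio_join (k : Priority M) : prio k ≫ join = join ≫ (prio k ⊗ₘ prio k)
  prio_bot (k : Priority M) : prio k ≫ bot = bot
  prio_meet (k : Priority M) : prio k ≫ meet = meet ≫ (prio k ⊗ₘ prio k)
  prio_top (k : Priority M) : prio k ≫ top = top

end Convolution

/-- A bounded distributive lattice with an action of the priorities by endomorphisms. -/
class PriorityLattice (M : ℕ) (L : Type*) extends DistribLattice L, BoundedOrder L where
  act : Priority M → L → L
  act_act (k l : Priority M) (a : L) : act k (act l a) = act (max k l) a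
  act_zero (a : L) : act 0 a = a
  act_sup (k : Priority M) (a b : L) : act k (a ⊔ b) = act k a ⊔ act k b
  act_bot (k : Priority M) : act k ⊥ = ⊥
  act_inf (k : Priority M) (a b : L) : act k (a ⊓ b) = act k a ⊓ act k b
  act_top (k : Priority M) : act k ⊤ = ⊤

namespace LatticeObj

variable {M : ℕ} {C : Type*} [Category C] [MonoidalCategory C] [BraidedCategory C]
variable {X K : C} [MonObj X] [LatticeObj X M] [MonObj K] [IsCommMonObj K]

attribute [instance] isMonHom_prio

instance : IsMonHom (join : X ⟶ X ⊗ X) := isCocommBimonoid_join.isMonHom_comul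
instance : IsMonHom (bot : X ⟶ 𝟙_ C) := isCocommBimonoid_join.isMonHom_counit
instance : IsMonHom (meet : X ⟶ X ⊗ X) := isCocommBimonoid_meet.isMonHom_comul
instance : IsMonHom (top : X ⟶ 𝟙_ C) := isCocommBimonoid_meet.isMonHom_counit

instance : Max (Mon.mk X ⟶ Mon.mk K) where
  max x y := Mon.ofHom (join ≫ tensorDesc x.hom y.hom)

instance : Min (Mon.mk X ⟶ Mon.mk K) where
  min x y := Mon.ofHom (meet ≫ tensorDesc x.hom y.hom)

instance : Top (Mon.mk X ⟶ Mon.mk K) where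
  top := Mon.ofHom (top ≫ η[K])

instance : Bot (Mon.mk X ⟶ Mon.mk K) where
  bot := Mon.ofHom (bot ≫ η[K])

variable (x y z : Mon.mk X ⟶ Mon.mk K)

theorem inf_sup_distrib : (x ⊓ y) ⊔ z = (x ⊔ z) ⊓ (y ⊔ z) :=
  Mon.Hom.ext' (distributes_join.convolution_convolution _ _ _)

theorem sup_inf_distrib : (x ⊔ y) ⊓ z = (x ⊓ z) ⊔ (y ⊓ z) :=
  Mon.Hom.ext' (distributes_meet.convolution_convolution _ _ _)

theorem hom_top_sup : ⊤ ⊔ x = ⊤ := Mon.Hom.ext' (distributes_join.unit_convolution _)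

theorem hom_bot_inf : ⊥ ⊓ x = ⊥ := Mon.Hom.ext' (distributes_meet.unit_convolution _)

theorem hom_bot_sup : ⊥ ⊔ x = x := Mon.Hom.ext' (isCocommBimonoid_join.unit_convolution _)

theorem hom_top_inf : ⊤ ⊓ x = x := Mon.Hom.ext' (isCocommBimonoid_meet.unit_convolution _)

theorem hom_sup_comm : x ⊔ y = y ⊔ x := Mon.Hom.ext' (isCocommBimonoid_join.convolution_comm _ _)

theorem hom_inf_comm : x ⊓ y = y ⊓ x := Mon.Hom.ext' (isCocommBimonoid_meet.convolution_comm _ _)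

theorem hom_sup_inf_self : x ⊔ x ⊓ y = x := by
  calc x ⊔ x ⊓ y = (⊤ ⊓ x) ⊔ (y ⊓ x) := by rw [hom_top_inf, hom_inf_comm x y]
    _ = x := by rw [← sup_inf_distrib, hom_top_sup, hom_top_inf]

theorem hom_inf_sup_self : x ⊓ (x ⊔ y) = x := by
  calc x ⊓ (x ⊔ y) = (⊥ ⊔ x) ⊓ (y ⊔ x) := by rw [hom_bot_sup, hom_sup_comm x y]
    _ = x := by rw [← inf_sup_distrib, hom_bot_inf, hom_bot_sup]

instance : Lattice (Mon.mk X ⟶ Mon.mk K) :=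
  Lattice.mk' hom_sup_comm
    (fun _ _ _ => Mon.Hom.ext' (isCocommBimonoid_join.convolution_assoc _ _ _)) hom_inf_comm
    (fun _ _ _ => Mon.Hom.ext' (isCocommBimonoid_meet.convolution_assoc _ _ _))
    hom_sup_inf_self hom_inf_sup_self

instance : DistribLattice (Mon.mk X ⟶ Mon.mk K) :=
  .ofInfSupLe fun x y z => by rw [inf_comm, sup_inf_distrib, inf_comm y, inf_comm z]

instance : PriorityLattice M (Mon.mk X ⟶ Mon.mk K) where
  le_top x := sup_eq_left.1 (hom_top_sup x)
  bot_le x := sup_eq_right.1 (hom_bot_sup x)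
  act k x := Mon.ofHom (prio k ≫ x.hom)
  act_act k l x := Mon.Hom.ext' (by
    change prio k ≫ prio l ≫ x.hom = prio (max k l) ≫ x.hom
    rw [← Category.assoc, prio_prio])
  act_zero x := Mon.Hom.ext' (by
    change prio 0 ≫ x.hom = x.hom
    rw [prio_zero, Category.id_comp])
  act_sup k x y := Mon.Hom.ext' (by
    change prio k ≫ join ≫ tensorDesc x.hom y.hom =
      join ≫ tensorDesc (prio k ≫ x.hom) (prio k ≫ y.hom)
    rw [← Category.assoc, prio_join, Category.assoc, tensorHom_comp_tensorDesc])
  act_inf k x y := Mon.Hom.ext' (by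
    change prio k ≫ meet ≫ tensorDesc x.hom y.hom =
      meet ≫ tensorDesc (prio k ≫ x.hom) (prio k ≫ y.hom)
    rw [← Category.assoc, prio_meet, Category.assoc, tensorHom_comp_tensorDesc])
  act_bot k := Mon.Hom.ext' (by
    change prio k ≫ bot ≫ η[K] = bot ≫ η[K]
    rw [← Category.assoc, prio_bot])
  act_top k := Mon.Hom.ext' (by
    change prio k ≫ top ≫ η[K] = top ≫ η[K]
    rw [← Category.assoc, prio_top])

end LatticeObj

/-! ### The lattice object of diagrams -/

namespace Word

variable {M : ℕ}

variable (M) in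
/-- The word of a single wire directed to the right. -/
def wire : Word M := ⟨[.right]⟩

theorem homMk_midSym :
    homMk Diagram.midSym = tensorμ (wire M) (wire M) (wire M) (wire M) :=
  homMk_eq <| .symm <| .comp_of_left_id (.retype_id _ _) <|
    .comp_of_left_id (.tensor_of_id (.refl _) (.retype_id _ _)) <| .trans
      (.comp_of_right_id (.refl _)
        (.comp_of_right_id (.tensor_of_id (.refl _) (.retype_id _ _)) (.retype_id _ _)))
      (.symm (.of_law (.tensor_assoc _ _ _)))

instance : MonObj (wire M) where
  one := homMk Diagram.start
  mul := homMk Diagram.merge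
  one_mul := homMk_eq <| .trans (.of_pgaAxiom .B3l) (.symm (.retype_id _ _))
  mul_one := homMk_eq <| .trans (.of_pgaAxiom .B3r) (.symm (.retype_id _ _))
  mul_assoc := homMk_eq <| .trans (.symm (.of_pgaAxiom .B1))
    (.symm (.comp_of_left_id (.retype_id _ _) (.refl _)))

instance : IsCommMonObj (wire M) where
  mul_comm := homMk_eq <| .of_pgaAxiom .B2

theorem isMonHom_homMk_comul {δ : Diagram M [.right] [.right, .right]}
    (h_merge : PGAEq (.comp .merge δ)
      (.comp (.tensor δ δ) (.comp .midSym (.tensor .merge .merge))))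
    (h_start : PGAEq (.comp .start δ) (.tensor .start .start)) :
    IsMonHom (M := wire M) (N := wire M ⊗ wire M) (homMk δ) where
  one_hom := homMk_eq <| h_start.trans (.symm (.comp_of_left_id (.retype_id _ _) (.refl _)))
  mul_hom := by
    change _ = _ ≫ tensorμ _ _ _ _ ≫ _
    rw [← homMk_midSym]
    exact homMk_eq h_merge

theorem isMonHom_homMk_counit {ε : Diagram M [.right] []}
    (h_merge : PGAEq (.comp .merge ε) (.tensor ε ε)) (h_start : PGAEq (.comp .start ε) .empty) :
    IsMonHom (M := wire M) (N := 𝟙_ (Word M)) (homMk ε) where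
  one_hom := homMk_eq h_start
  mul_hom := homMk_eq <| h_merge.trans (.symm (.comp_of_right_id (.refl _) (.retype_id _ _)))

theorem isCocommBimonoid_homMk {δ : Diagram M [.right] [.right, .right]}
    {ε : Diagram M [.right] []} (hδ : IsMonHom (M := wire M) (N := wire M ⊗ wire M) (homMk δ))
    (hε : IsMonHom (M := wire M) (N := 𝟙_ (Word M)) (homMk ε))
    (h_assoc : PGAEq (.comp δ (.tensor δ .wire)) (.comp δ (.tensor .wire δ)))
    (h_comm : PGAEq (.comp δ .sym) δ) (h_counit : PGAEq (.comp δ (.tensor ε .wire)) .wire) :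
    IsCocommBimonoid (X := wire M) (homMk δ) (homMk ε) where
  isMonHom_comul := hδ
  isMonHom_counit := hε
  comul_assoc := homMk_eq <| h_assoc.symm.trans
    (.comp (.refl _) (.symm (.comp_of_right_id (.refl _) (.retype_id _ _))))
  comul_comm := homMk_eq h_comm
  counit_comul := homMk_eq <| h_counit.trans (.symm (.retype_id _ _))

theorem distributes_homMk {δ δ' : Diagram M [.right] [.right, .right]}
    {ε' : Diagram M [.right] []}
    (h_comul : PGAEq (.comp δ (.tensor δ' .wire))
      (.comp δ' (.comp (.tensor δ δ) (.comp .midSym (.tensor (.id [.right, .right]) .merge)))))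
    (h_counit : PGAEq (.comp δ (.tensor ε' .wire)) (.comp ε' .start)) :
    Distributes (X := wire M) (homMk δ) (homMk δ') (homMk ε') where
  comul := by
    rw [← homMk_midSym]
    exact homMk_eq h_comul
  counit := homMk_eq <| h_counit.trans
    (.comp (.refl _) (.symm (.comp_of_right_id (.refl _) (.retype_id _ _))))

instance : LatticeObj (wire M) M where
  join := homMk Diagram.player0
  bot := homMk Diagram.lose0
  meet := homMk Diagram.player1
  top := homMk Diagram.lose1
  prio k := homMk (Diagram.prio k)
  isCocommBimonoid_join := isCocommBimonoid_homMk
    (isMonHom_homMk_comul (.of_pgaAxiom .B10) (.of_pgaAxiom .B12))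
    (isMonHom_homMk_counit (.of_pgaAxiom .B11) (.of_pgaAxiom .B14))
    (.of_pgaAxiom .B4) (.of_pgaAxiom .B5) (.of_pgaAxiom .B6r)
  isCocommBimonoid_meet := isCocommBimonoid_homMk
    (isMonHom_homMk_comul (.of_pgaAxiom .B18) (.of_pgaAxiom .B13))
    (isMonHom_homMk_counit (.of_pgaAxiom .B19) (.of_pgaAxiom .B15))
    (.of_pgaAxiom .B7) (.of_pgaAxiom .B8) (.of_pgaAxiom .B9r)
  distributes_join := distributes_homMk (.of_pgaAxiom .B20) (.of_pgaAxiom .B21)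
  distributes_meet := distributes_homMk (.of_pgaAxiom .B22) (.of_pgaAxiom .B23)
  isMonHom_prio k := {
    one_hom := homMk_eq <| .of_pgaAxiom (.C2 k)
    mul_hom := homMk_eq <| .symm (.of_pgaAxiom (.C1 k)) }
  prio_prio k l := homMk_eq <| .of_pgaAxiom (.C3 k l)
  prio_zero := homMk_eq <| .of_pgaAxiom .C4
  prio_join k := homMk_eq <| .of_pgaAxiom (.D1 k)
  prio_bot k := homMk_eq <| .of_pgaAxiom (.D2 k)
  prio_meet k := homMk_eq <| .of_pgaAxiom (.D3 k)
  prio_top k := homMk_eq <| .of_pgaAxiom (.D4 k)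

end Word

/-! ### The interpretation of diagrams in priority lattices -/

section Interpretation

variable {M : ℕ} {L L' : Type*} [PriorityLattice M L] [PriorityLattice M L']

open PriorityLattice (act)

/-- The interpretation of a generator in a lattice, which maps values of the wires of its target to
values of the wires of its source. Wires are numbered from the left, and the values at the numbers
that are not wires, or for a cap or a cup, are irrelevant. -/
def Gen.interp : ∀ {v w : List Dir}, Gen M v w → (ℕ → L) → ℕ → L
  | _, _, player0, x, _ => x 0 ⊔ x 1
  | _, _, lose0, _, _ => ⊥
  | _, _, player1, x, _ => x 0 ⊓ x 1
  | _, _, lose1, _, _ => ⊤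
  | _, _, merge, x, _ => x 0
  | _, _, start, _, _ => ⊥
  | _, _, prio p, x, _ => act p (x 0)
  | _, _, cap, _, _ => ⊥
  | _, _, cup, _, _ => ⊥

/-- The interpretation of an acyclic diagram in a lattice, with the conventions of `Gen.interp`. -/
def Diagram.interp : ∀ {v w : List Dir}, Diagram M v w → (ℕ → L) → ℕ → L
  | _, _, gen g, x, i => g.interp x i
  | _, _, id _, x, i => x i
  | _, _, swap v w, x, i => if i < v.length then x (w.length + i) else x (i - v.length)
  | _, _, comp c d, x, i => c.interp (d.interp x) i
  | _, _, tensor (v := v) (w := w) c d, x, i =>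
    if i < v.length then c.interp x i else d.interp (fun j => x (w.length + j)) (i - v.length)

theorem Diagram.map_interp (f : BoundedLatticeHom L L')
    (hf : ∀ (k : Priority M) a, f (act k a) = act k (f a)) {v w : List Dir} (c : Diagram M v w)
    (x : ℕ → L) (i : ℕ) : f (c.interp x i) = c.interp (fun j => f (x j)) i := by
  induction c generalizing x i with
  | gen g => cases g <;> simp only [interp, Gen.interp, map_sup, map_inf, map_bot, map_top, hf]
  | id v => rfl
  | swap v w => simp only [interp, apply_ite f]
  | comp c d ihc ihd => simp only [interp, ihc, ihd]
  | tensor c d ihc ihd => simp only [interp, apply_ite f, ihc, ihd]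

end Interpretation

theorem left_notMem_rightWires (n : ℕ) : Dir.left ∉ rightWires n := by
  simp [rightWires, List.mem_replicate]

section Acyclic

variable {M : ℕ} {v w : List Dir}

theorem not_isAcyclic_cap : ¬ (Diagram.gen (Gen.cap : Gen M _ _)).IsAcyclic := by
  rintro (h | h | h | h) <;> cases h

theorem not_isAcyclic_cup : ¬ (Diagram.gen (Gen.cup : Gen M _ _)).IsAcyclic := by
  rintro (h | h | h | h) <;> cases h

theorem Diagram.IsAcyclic.left_notMem {c : Diagram M v w} (hc : c.IsAcyclic)
    (hv : Dir.left ∉ v) : Dir.left ∉ w := by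
  induction c with
  | gen g => rcases hc with h | h | h | h <;> cases h <;> simp
  | id v => exact hv
  | swap v w => exact fun h => hv (by simpa only [List.mem_append, or_comm] using h)
  | comp c d ihc ihd => exact ihd hc.2 (ihc hc.1 hv)
  | tensor c d ihc ihd =>
    rw [List.mem_append, not_or] at hv ⊢
    exact ⟨ihc hc.1 hv.1, ihd hc.2 hv.2⟩

end Acyclic

namespace Word

variable {M : ℕ} {K : Word M} [MonObj K] {v w : List Dir}

/-- The homomorphism out of a tensor power of the wire that is given by its components. -/
def copair : ∀ v : List Dir, Dir.left ∉ v → (ℕ → (Mon.mk (wire M) ⟶ Mon.mk K)) →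
    ((⟨v⟩ : Word M) ⟶ K)
  | [], _, _ => η[K]
  | .right :: v, hv, x =>
    tensorDesc (x 0).hom (copair v (List.not_mem_of_not_mem_cons hv) fun i => x (i + 1))
  | .left :: _, hv, _ => absurd List.mem_cons_self hv

theorem copair_cons (hv : Dir.left ∉ Dir.right :: v) (x : ℕ → (Mon.mk (wire M) ⟶ Mon.mk K)) :
    copair (.right :: v) hv x = tensorDesc (Y := wire M) (Z := ⟨v⟩) (x 0).hom
      (copair v (List.not_mem_of_not_mem_cons hv) fun i => x (i + 1)) :=
  rfl

theorem copair_congr (hv : Dir.left ∉ v) {x y : ℕ → (Mon.mk (wire M) ⟶ Mon.mk K)}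
    (hxy : ∀ i < v.length, x i = y i) : copair v hv x = copair v hv y := by
  induction v generalizing x y with
  | nil => rfl
  | cons a v ih =>
    cases a with
    | left => exact absurd List.mem_cons_self hv
    | right =>
      rw [copair_cons, copair_cons, hxy 0 (Nat.succ_pos _),
        ih _ fun i hi => hxy (i + 1) (Nat.succ_lt_succ hi)]

theorem copair_append (hvw : Dir.left ∉ v ++ w) (x : ℕ → (Mon.mk (wire M) ⟶ Mon.mk K)) :
    copair (v ++ w) hvw x = tensorDesc (Y := (⟨v⟩ : Word M)) (Z := ⟨w⟩)
      (copair v (mt (List.mem_append_left _) hvw) x)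
      (copair w (mt (List.mem_append_right _) hvw) fun i => x (v.length + i)) := by
  induction v generalizing x with
  | nil =>
    simp only [List.length_nil, Nat.zero_add]
    exact ((one_tensorDesc _).trans (Category.id_comp _)).symm
  | cons a v ih =>
    cases a with
    | left => exact absurd List.mem_cons_self hvw
    | right =>
      have h_tail := ih (List.not_mem_of_not_mem_cons hvw) fun i => x (i + 1)
      have h_assoc := associator_comp_tensorDesc (Y := wire M) (Z := ⟨v⟩) (W := ⟨w⟩) (x 0).hom
        (copair v (mt (List.mem_append_left _) (List.not_mem_of_not_mem_cons hvw))
          fun i => x (i + 1))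
        (copair w (mt (List.mem_append_right _) hvw) fun i => x (v.length + i + 1))
      simp only [List.length_cons, Nat.add_right_comm v.length 1]
      refine (congrArg (tensorDesc (x 0).hom) h_tail).trans (.trans ?_ h_assoc)
      exact (Category.id_comp _).symm

theorem copair_singleton (hv : Dir.left ∉ [Dir.right])
    (x : ℕ → (Mon.mk (wire M) ⟶ Mon.mk K)) : copair [.right] hv x = (x 0).hom :=
  (tensorDesc_one _).trans (Category.id_comp _)

theorem copair_pair (hv : Dir.left ∉ [Dir.right, Dir.right])
    (x : ℕ → (Mon.mk (wire M) ⟶ Mon.mk K)) :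
    copair [.right, .right] hv x = tensorDesc (x 0).hom (x 1).hom :=
  congrArg (tensorDesc (x 0).hom)
    (copair_singleton (List.not_mem_of_not_mem_cons hv) fun i => x (i + 1))

theorem copair_comp {K' : Word M} [MonObj K'] (hv : Dir.left ∉ v)
    (x : ℕ → (Mon.mk (wire M) ⟶ Mon.mk K)) (f : Mon.mk K ⟶ Mon.mk K') :
    copair v hv x ≫ f.hom = copair v hv fun i => x i ≫ f := by
  induction v generalizing x with
  | nil => exact IsMonHom.one_hom f.hom
  | cons a v ih =>
    cases a with
    | left => exact absurd List.mem_cons_self hv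
    | right =>
      exact (tensorDesc_comp _ _ f.hom).trans
        (congrArg (tensorDesc ((x 0).hom ≫ f.hom)) (ih _ fun i => x (i + 1)))

variable [IsCommMonObj K]

theorem homMk_gen_comp_copair {g : Gen M v w} (hg : (Diagram.gen g).IsAcyclic)
    (hv : Dir.left ∉ v) (hw : Dir.left ∉ w) (x : ℕ → (Mon.mk (wire M) ⟶ Mon.mk K)) :
    homMk (.gen g) ≫ copair w hw x = copair v hv (g.interp x) := by
  cases g with
  | player0 => rw [copair_pair, copair_singleton]; rfl
  | lose0 => rw [copair_singleton]; rfl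
  | player1 => rw [copair_pair, copair_singleton]; rfl
  | lose1 => rw [copair_singleton]; rfl
  | merge =>
    rw [copair_pair, copair_singleton]
    exact IsMonHom.mul_hom (x 0).hom
  | start =>
    rw [copair_singleton]
    exact IsMonHom.one_hom (x 0).hom
  | prio p => rw [copair_singleton, copair_singleton]; rfl
  | cap => exact absurd hg not_isAcyclic_cap
  | cup => exact absurd hg not_isAcyclic_cup

theorem homMk_swap_comp_copair (hv : Dir.left ∉ v ++ w) (hw : Dir.left ∉ w ++ v)
    (x : ℕ → (Mon.mk (wire M) ⟶ Mon.mk K)) :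
    homMk (.swap v w) ≫ copair (w ++ v) hw x =
      copair (v ++ w) hv ((Diagram.swap (M := M) v w).interp x) := by
  rw [copair_append, copair_append]
  refine (braiding_comp_tensorDesc _ _).trans (congrArg₂ tensorDesc ?_ ?_)
  · exact copair_congr _ fun i hi => by simp only [Diagram.interp, if_pos hi]
  · exact copair_congr _ fun i _ => by
      simp only [Diagram.interp, Nat.not_lt.2 (Nat.le_add_right _ _), if_false,
        Nat.add_sub_cancel_left]

theorem homMk_comp_copair {c : Diagram M v w} (hc : c.IsAcyclic) (hv : Dir.left ∉ v)
    (hw : Dir.left ∉ w) (x : ℕ → (Mon.mk (wire M) ⟶ Mon.mk K)) :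
    homMk c ≫ copair w hw x = copair v hv (c.interp x) := by
  induction c generalizing x with
  | gen g => exact homMk_gen_comp_copair hc hv hw x
  | id v => exact Category.id_comp _
  | swap v w => exact homMk_swap_comp_copair hv hw x
  | comp c d ihc ihd =>
    rw [homMk_comp, Category.assoc, ihd hc.2 (Diagram.IsAcyclic.left_notMem hc.1 hv), ihc hc.1 hv]
    rfl
  | @tensor v w v' w' c d ihc ihd =>
    rw [copair_append, copair_append, homMk_tensor]
    refine (tensorHom_comp_tensorDesc _ _ _ _).trans (congrArg₂ tensorDesc ?_ ?_)
    · rw [ihc hc.1 (mt (List.mem_append_left _) hv)]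
      exact copair_congr _ fun i hi => by simp only [Diagram.interp, if_pos hi]
    · rw [ihd hc.2 (mt (List.mem_append_right _) hv)]
      exact copair_congr _ fun i _ => by
        simp only [Diagram.interp, Nat.not_lt.2 (Nat.le_add_right _ _), if_false,
          Nat.add_sub_cancel_left]

end Word

/-! ### Separation by truth values -/

section Separation

/-- The indicator of the complement of a prime ideal. -/
def primeIdealHom {L : Type*} [Lattice L] [BoundedOrder L] (J : Order.Ideal L)
    (hJ : J.IsPrime) : BoundedLatticeHom L Prop where
  toFun a := a ∉ J
  map_sup' a b := by simp only [Order.Ideal.sup_mem_iff, sup_Prop_eq, not_and_or]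
  map_inf' a b := propext <| by
    change a ⊓ b ∉ J ↔ a ∉ J ∧ b ∉ J
    rw [← not_or, not_iff_not]
    exact ⟨hJ.mem_or_mem, Or.rec (J.lower inf_le_left) (J.lower inf_le_right)⟩
  map_top' := eq_true hJ.toIsProper.top_notMem
  map_bot' := eq_false (not_not_intro J.bot_mem)

theorem le_of_forall_hom_prop {L : Type*} [DistribLattice L] [BoundedOrder L] {a b : L}
    (h : ∀ f : BoundedLatticeHom L Prop, f a → f b) : a ≤ b := by
  by_contra h_not_le
  have h_disjoint :
      Disjoint (Order.PFilter.principal a : Set L) (Order.Ideal.principal b : Set L) :=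
    Set.disjoint_left.2 fun c hac hcb => h_not_le <|
      (Order.PFilter.mem_principal.1 hac).trans (Order.Ideal.mem_principal.1 hcb)
  obtain ⟨J, hJ, hbJ, haJ⟩ := DistribLattice.prime_ideal_of_disjoint_filter_ideal h_disjoint
  exact h (primeIdealHom J hJ)
    (Set.disjoint_left.1 haJ (Order.PFilter.mem_principal.2 le_rfl))
    (hbJ (Order.Ideal.mem_principal.2 le_rfl))

variable {M : ℕ} {L B : Type*} [PriorityLattice M L] [DistribLattice B] [BoundedOrder B]

instance : PriorityLattice M (Priority M → B) where
  act k f l := f (max l k)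
  act_act k l f := funext fun j => congrArg f (max_assoc j k l)
  act_zero f := funext fun j => congrArg f (max_eq_left (Fin.zero_le j))
  act_sup _ _ _ := rfl
  act_bot _ := rfl
  act_inf _ _ _ := rfl
  act_top _ := rfl

namespace PriorityLattice

/-- The equivariant homomorphism to `Priority M → B` that corresponds to a homomorphism to `B`:
the lattice `Priority M → B` is cofreely generated by `B`. -/
def orbitHom (f : BoundedLatticeHom L B) : BoundedLatticeHom L (Priority M → B) where
  toFun a k := f (act k a)
  map_sup' a b := funext fun k => by rw [act_sup, map_sup]; rfl
  map_inf' a b := funext fun k => by rw [act_inf, map_inf]; rfl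
  map_top' := funext fun k => by rw [act_top, map_top]; rfl
  map_bot' := funext fun k => by rw [act_bot, map_bot]; rfl

theorem orbitHom_act (f : BoundedLatticeHom L B) (k : Priority M) (a : L) :
    orbitHom f (act k a) = act k (orbitHom (M := M) f a) :=
  funext fun l => congrArg f (act_act l k a)

theorem orbitHom_apply_zero (f : BoundedLatticeHom L B) (a : L) :
    orbitHom (M := M) f a 0 = f a :=
  congrArg f (act_zero a)

end PriorityLattice

theorem Diagram.interp_le_of_prop {v w v' w' : List Dir} {c : Diagram M v w}
    {d : Diagram M v' w'} {i : ℕ}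
    (h : ∀ T : ℕ → Priority M → Prop, c.interp T i 0 → d.interp T i 0) (x : ℕ → L) :
    c.interp x i ≤ d.interp x i := by
  refine le_of_forall_hom_prop fun f => ?_
  have h_orbit {u u' : List Dir} (e : Diagram M u u') :
      f (e.interp x i) = e.interp (fun j => PriorityLattice.orbitHom (M := M) f (x j)) i 0 := by
    rw [← Diagram.map_interp _ (PriorityLattice.orbitHom_act f),
      PriorityLattice.orbitHom_apply_zero]
  rw [h_orbit c, h_orbit d]
  exact h _

theorem Diagram.interp_eq_of_prop {v w v' w' : List Dir} {c : Diagram M v w}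
    {d : Diagram M v' w'} {i : ℕ}
    (h : ∀ T : ℕ → Priority M → Prop, c.interp T i 0 ↔ d.interp T i 0) (x : ℕ → L) :
    c.interp x i = d.interp x i :=
  le_antisymm (interp_le_of_prop (fun T => (h T).1) x) (interp_le_of_prop (fun T => (h T).2) x)

end Separation

/-! ### Completeness for the interpretation in truth values -/

namespace Word

variable {M : ℕ}

variable (M) in
/-- The word of `n` wires directed to the right, the `n`-th tensor power of the wire. -/
abbrev wires (n : ℕ) : Word M := ⟨rightWires n⟩

instance monObjWires : ∀ n : ℕ, MonObj (wires M n)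
  | 0 => inferInstanceAs (MonObj (𝟙_ (Word M)))
  | n + 1 =>
    have := monObjWires n
    inferInstanceAs (MonObj (wire M ⊗ wires M n))

instance isCommMonObjWires : ∀ n : ℕ, IsCommMonObj (wires M n)
  | 0 => inferInstanceAs (IsCommMonObj (𝟙_ (Word M)))
  | n + 1 =>
    have := isCommMonObjWires n
    inferInstanceAs (IsCommMonObj (wire M ⊗ wires M n))

/-- The coprojections of the wire to its `n`-th tensor power. They are irrelevant at the numbers
from `n` on. -/
def coproj : ∀ n : ℕ, ℕ → (Mon.mk (wire M) ⟶ Mon.mk (wires M n))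
  | 0, _ => ⊥
  | n + 1, 0 => tensorInl (wire M) (wires M n)
  | n + 1, i + 1 => coproj n i ≫ tensorInr (wire M) (wires M n)

theorem copair_coproj (n : ℕ) :
    copair (rightWires n) (left_notMem_rightWires n) (coproj n) = 𝟙 (wires M n) := by
  induction n with
  | zero => rfl
  | succ n ih =>
    have h_tail : copair (rightWires n) (left_notMem_rightWires n)
        (fun i => coproj n i ≫ tensorInr (wire M) (wires M n)) =
          (tensorInr (wire M) (wires M n)).hom := by
      rw [← copair_comp, ih]
      exact Category.id_comp _
    exact (congrArg (tensorDesc (tensorInl (wire M) (wires M n)).hom) h_tail).trans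
      tensorDesc_inl_inr

theorem homMk_eq_copair_interp_coproj {m n : ℕ} {c : Diagram M (rightWires m) (rightWires n)}
    (hc : c.IsAcyclic) :
    homMk c = copair (rightWires m) (left_notMem_rightWires m) (c.interp (coproj n)) := by
  rw [← homMk_comp_copair hc _ (left_notMem_rightWires n), copair_coproj, Category.comp_id]

end Word

theorem PGAEq.of_interp {M m n : ℕ} {c d : Diagram M (rightWires m) (rightWires n)}
    (hc : c.IsAcyclic) (hd : d.IsAcyclic)
    (h : ∀ T : ℕ → Priority M → Prop, ∀ i < m, c.interp T i 0 ↔ d.interp T i 0) :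
    PGAEq c d := by
  rw [← Word.homMk_eq_iff, Word.homMk_eq_copair_interp_coproj hc,
    Word.homMk_eq_copair_interp_coproj hd]
  exact Word.copair_congr _ fun i hi => Diagram.interp_eq_of_prop
    (fun T => h T i (by simpa only [List.length_replicate] using hi)) _

/-! ### Solutions of well-founded games -/

namespace Game

variable {M : ℕ}

section Semantics

variable {v w : List Dir} (A : Game M v w)

/-- A game is terminating if its internal positions are well-founded along the edges. All its plays
are then finite, so that it can be solved by recursion on the positions. -/
def IsTerminating : Prop :=
  WellFounded fun y x : A.V => A.E (Sum.inr x) (Sum.inl y)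

/-- A valuation of the positions of a game, given the greatest priority seen before, which is
locally consistent: the value of an entry is that of its successor, and an internal position has
the value true if some successor has (for Player 0), or if all of them have (for Player 1). -/
structure IsSolution (I : Entry v w → Priority M → Prop) (X : A.V → Priority M → Prop)
    (T : Exit v w → Priority M → Prop) : Prop where
  entry : ∀ i y, A.E (Sum.inl i) y → ∀ k, I i k ↔ Sum.elim X T y k
  player0 : ∀ x ∈ A.V₀, ∀ k, X x k ↔
    ∃ y, A.E (Sum.inr x) y ∧ Sum.elim X T y (max k (A.label x))
  player1 : ∀ x ∉ A.V₀, ∀ k, X x k ↔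
    ∀ y, A.E (Sum.inr x) y → Sum.elim X T y (max k (A.label x))

theorem maxPriority_append_entry (h : List (Entry v w ⊕ A.V)) (i : Entry v w) :
    A.maxPriority (h ++ [Sum.inl i]) = A.maxPriority h := by
  induction h with
  | nil => rfl
  | cons a h ih => rcases a with a | a <;> simp [maxPriority, ih]

theorem maxPriority_append_internal (h : List (Entry v w ⊕ A.V)) (x : A.V) :
    A.maxPriority (h ++ [Sum.inr x]) = max (A.maxPriority h) (A.label x) := by
  induction h with
  | nil => simp [maxPriority]
  | cons a h ih => rcases a with a | a <;> simp [maxPriority, ih, max_assoc]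

theorem exists_strategy (P : Set A.V) (Q : List (Entry v w ⊕ A.V) → P → A.V ⊕ Exit v w → Prop) :
    ∃ σ : A.Strategy P, ∀ h x, (∃ y, A.E (Sum.inr x.1) y ∧ Q h x y) → Q h x (σ.next h x) := by
  have h_next : ∀ (h : List (Entry v w ⊕ A.V)) (x : P), ∃ z : A.V ⊕ Exit v w,
      ((∃ y, A.E (Sum.inr x.1) y) → A.E (Sum.inr x.1) z) ∧
      ((∃ y, A.E (Sum.inr x.1) y ∧ Q h x y) → Q h x z) := by
    intro h x
    by_cases hQ : ∃ y, A.E (Sum.inr x.1) y ∧ Q h x y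
    · obtain ⟨y, hy, hQy⟩ := hQ
      exact ⟨y, fun _ => hy, fun _ => hQy⟩
    · by_cases hE : ∃ y, A.E (Sum.inr x.1) y
      · exact ⟨hE.choose, fun _ => hE.choose_spec, fun h => absurd h hQ⟩
      · exact ⟨Sum.inl x.1, fun h => absurd h hE, fun h => absurd h hQ⟩
  choose next h_edge h_prop using h_next
  exact ⟨⟨next, h_edge⟩, h_prop⟩

variable {A}

theorem entryNext_edge (i : Entry v w) : A.E (Sum.inl i) (A.entryNext i) :=
  (A.entry_unique i).choose_spec.1

section Plays

variable {σ₀ : A.Strategy A.V₀} {σ₁ : A.Strategy A.V₀ᶜ} {i : Entry v w}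

theorem exists_edge_nextStage_eq (past : List (Entry v w ⊕ A.V)) {x : A.V}
    (hx : ∃ y, A.E (Sum.inr x) y) :
    ∃ y, A.E (Sum.inr x) y ∧
      A.nextStage σ₀ σ₁ ⟨past, Sum.inl (Sum.inr x)⟩ = some (Stage.move A past (Sum.inr x) y) := by
  simp only [nextStage, if_pos hx, Option.some.injEq]
  split_ifs with hx₀
  · exact ⟨_, σ₀.next_edge past ⟨x, hx₀⟩ hx, rfl⟩
  · exact ⟨_, σ₁.next_edge past ⟨x, hx₀⟩ hx, rfl⟩

theorem play_succ {n : ℕ} {s : A.Stage} (hs : A.play σ₀ σ₁ i n = some s) :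
    A.play σ₀ σ₁ i (n + 1) = A.nextStage σ₀ σ₁ s := by
  simp only [play, hs, Option.bind_some]

theorem play_induction {Q : A.Stage → Prop} (start : Q ⟨[], Sum.inl (Sum.inl i)⟩)
    (entry : ∀ past i, Q ⟨past, Sum.inl (Sum.inl i)⟩ →
      Q (Stage.move A past (Sum.inl i) (A.entryNext i)))
    (player0 : ∀ past (x : A.V₀), (∃ y, A.E (Sum.inr x.1) y) → Q ⟨past, Sum.inl (Sum.inr x)⟩ →
      Q (Stage.move A past (Sum.inr x) (σ₀.next past x)))
    (player1 : ∀ past (x : ↑A.V₀ᶜ), (∃ y, A.E (Sum.inr x.1) y) → Q ⟨past, Sum.inl (Sum.inr x)⟩ →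
      Q (Stage.move A past (Sum.inr x) (σ₁.next past x)))
    {n : ℕ} {s : A.Stage} (hs : A.play σ₀ σ₁ i n = some s) : Q s := by
  induction n generalizing s with
  | zero => exact Option.some.inj hs ▸ start
  | succ n ih =>
    obtain ⟨⟨past, (i | x) | o⟩, h_prev, h_next⟩ := Option.bind_eq_some_iff.1 hs
    · exact Option.some.inj h_next ▸ entry past i (ih h_prev)
    · simp only [nextStage] at h_next
      split_ifs at h_next with hE hx
      · exact Option.some.inj h_next ▸ player0 past ⟨x, hx⟩ hE (ih h_prev)
      · exact Option.some.inj h_next ▸ player1 past ⟨x, hx⟩ hE (ih h_prev)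
    · cases h_next

/-- The play reaches an exit, or an internal position without outgoing edges. -/
def PlayStops (σ₀ : A.Strategy A.V₀) (σ₁ : A.Strategy A.V₀ᶜ) (i : Entry v w) : Prop :=
  ∃ n past, (∃ o, A.play σ₀ σ₁ i n = some ⟨past, Sum.inr o⟩) ∨
    ∃ x, A.play σ₀ σ₁ i n = some ⟨past, Sum.inl (Sum.inr x)⟩ ∧ ¬ ∃ y, A.E (Sum.inr x) y

theorem IsTerminating.playStops_of_internal (hA : A.IsTerminating) {n : ℕ}
    {past : List (Entry v w ⊕ A.V)} {x : A.V}
    (hx : A.play σ₀ σ₁ i n = some ⟨past, Sum.inl (Sum.inr x)⟩) : PlayStops σ₀ σ₁ i := by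
  induction x using hA.induction generalizing n past with
  | h x ih =>
    by_cases hE : ∃ y, A.E (Sum.inr x) y
    · obtain ⟨y | o, hy, h_next⟩ := exists_edge_nextStage_eq (σ₀ := σ₀) (σ₁ := σ₁) past hE
      · exact ih y hy ((play_succ hx).trans h_next)
      · exact ⟨_, _, .inl ⟨o, (play_succ hx).trans h_next⟩⟩
    · exact ⟨n, past, .inr ⟨x, hx, hE⟩⟩

theorem IsTerminating.playStops (hA : A.IsTerminating) (σ₀ : A.Strategy A.V₀)
    (σ₁ : A.Strategy A.V₀ᶜ) (i : Entry v w) : PlayStops σ₀ σ₁ i := by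
  have h_one : A.play σ₀ σ₁ i 1 = some (Stage.move A [] (Sum.inl i) (A.entryNext i)) := rfl
  rcases h : A.entryNext i with x | o
  · exact hA.playStops_of_internal (h ▸ h_one)
  · exact ⟨1, _, .inl ⟨o, h ▸ h_one⟩⟩

theorem PlayStops.exists_play_eq_none (h : PlayStops σ₀ σ₁ i) : ∃ n, A.play σ₀ σ₁ i n = none := by
  obtain ⟨n, past, ⟨o, ho⟩ | ⟨x, hx, hE⟩⟩ := h
  · exact ⟨n + 1, play_succ ho⟩
  · exact ⟨n + 1, (play_succ hx).trans (if_neg hE)⟩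

end Plays

/-- The value of a finite play in a valuation of the positions. -/
def Stage.value (I : Entry v w → Priority M → Prop) (X : A.V → Priority M → Prop)
    (T : Exit v w → Priority M → Prop) (s : A.Stage) : Prop :=
  Sum.elim (Sum.elim I X) T s.current (A.maxPriority s.past)

section Value

variable {I : Entry v w → Priority M → Prop} {X : A.V → Priority M → Prop}
  {T : Exit v w → Priority M → Prop}

theorem Stage.value_move (past : List (Entry v w ⊕ A.V)) (x : Entry v w ⊕ A.V)
    (y : A.V ⊕ Exit v w) :
    (Stage.move A past x y).value I X T ↔ Sum.elim X T y (A.maxPriority (past ++ [x])) := by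
  rcases y with y | y <;> rfl

namespace IsSolution

theorem value_entry (h : A.IsSolution I X T) (past : List (Entry v w ⊕ A.V)) (i : Entry v w) :
    Stage.value I X T ⟨past, Sum.inl (Sum.inl i)⟩ ↔
      (Stage.move A past (Sum.inl i) (A.entryNext i)).value I X T := by
  rw [Stage.value_move, maxPriority_append_entry]
  exact h.entry i _ (entryNext_edge i) _

theorem value_player0 (h : A.IsSolution I X T) (past : List (Entry v w ⊕ A.V)) (x : A.V₀) :
    Stage.value I X T ⟨past, Sum.inl (Sum.inr x)⟩ ↔
      ∃ y, A.E (Sum.inr x) y ∧ (Stage.move A past (Sum.inr x) y).value I X T := by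
  simp only [Stage.value_move, maxPriority_append_internal]
  exact h.player0 x x.2 _

theorem value_player1 (h : A.IsSolution I X T) (past : List (Entry v w ⊕ A.V)) (x : ↑A.V₀ᶜ) :
    Stage.value I X T ⟨past, Sum.inl (Sum.inr x)⟩ ↔
      ∀ y, A.E (Sum.inr x) y → (Stage.move A past (Sum.inr x) y).value I X T := by
  simp only [Stage.value_move, maxPriority_append_internal]
  exact h.player1 x x.2 _

theorem exists_strategy_value (h : A.IsSolution I X T) :
    ∃ σ₀ : A.Strategy A.V₀, ∀ (σ₁ : A.Strategy A.V₀ᶜ) (i n s),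
      I i 0 → A.play σ₀ σ₁ i n = some s → s.value I X T := by
  obtain ⟨σ₀, hσ₀⟩ := A.exists_strategy A.V₀ fun past x y =>
    (Stage.move A past (Sum.inr x) y).value I X T
  exact ⟨σ₀, fun σ₁ i n s hi => play_induction hi (fun past i => (h.value_entry past i).1)
    (fun past x _ hx => hσ₀ past x ((h.value_player0 past x).1 hx))
    (fun past x hE hx => (h.value_player1 past x).1 hx _ (σ₁.next_edge past x hE))⟩

theorem exists_strategy_not_value (h : A.IsSolution I X T) :
    ∃ σ₁ : A.Strategy A.V₀ᶜ, ∀ (σ₀ : A.Strategy A.V₀) (i n s),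
      ¬ I i 0 → A.play σ₀ σ₁ i n = some s → ¬ s.value I X T := by
  obtain ⟨σ₁, hσ₁⟩ := A.exists_strategy A.V₀ᶜ fun past x y =>
    ¬ (Stage.move A past (Sum.inr x) y).value I X T
  refine ⟨σ₁, fun σ₀ i n s hi => play_induction (Q := fun s => ¬ s.value I X T) hi
    (fun past i => mt (h.value_entry past i).2)
    (fun past x hE hx hy =>
      hx ((h.value_player0 past x).2 ⟨_, σ₀.next_edge past x hE, hy⟩))
    (fun past x _ hx => hσ₁ past x ?_)⟩
  simpa only [h.value_player1 past x, not_forall, exists_prop] using hx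

theorem mem_semantics (h : A.IsSolution I X T) (hA : A.IsTerminating) {i : Entry v w} (hi : I i 0) :
    ({e | T e.1 e.2}, i) ∈ A.semantics := by
  obtain ⟨σ₀, hσ₀⟩ := h.exists_strategy_value
  refine ⟨σ₀, ?_, ?_⟩
  · rintro ⟨σ₁, hd⟩
    cases hd with
    | stuck₀ hn hx hE =>
      obtain ⟨y, hy, -⟩ := (h.value_player0 _ ⟨_, hx⟩).1 (hσ₀ σ₁ _ _ _ hi hn)
      exact hE ⟨y, hy⟩
    | odd hinf _ _ =>
      obtain ⟨n, hn⟩ := (hA.playStops σ₀ σ₁ i).exists_play_eq_none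
      exact hinf n hn
  · rintro ⟨o, k⟩ ⟨σ₁, hd⟩
    cases hd with
    | exit hn => exact hσ₀ σ₁ _ _ _ hi hn

theorem notMem_semantics (h : A.IsSolution I X T) (hA : A.IsTerminating) {i : Entry v w}
    (hi : ¬ I i 0) : ({e | T e.1 e.2}, i) ∉ A.semantics := by
  rintro ⟨σ₀, h_lose, h_out⟩
  obtain ⟨σ₁, hσ₁⟩ := h.exists_strategy_not_value
  obtain ⟨n, past, ⟨o, ho⟩ | ⟨x, hx, hE⟩⟩ := hA.playStops σ₀ σ₁ i
  · exact hσ₁ σ₀ _ _ _ hi ho (h_out (a := (o, A.maxPriority past)) ⟨σ₁, .exit ho⟩)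
  · by_cases hx₀ : x ∈ A.V₀
    · exact h_lose ⟨σ₁, .stuck₀ hx hx₀ hE⟩
    · exact hσ₁ σ₀ _ _ _ hi hx
        ((h.value_player1 past ⟨x, hx₀⟩).2 fun y hy => absurd ⟨y, hy⟩ hE)

theorem mem_semantics_iff (h : A.IsSolution I X T) (hA : A.IsTerminating) (i : Entry v w) :
    ({e | T e.1 e.2}, i) ∈ A.semantics ↔ I i 0 :=
  ⟨fun hi => by_contra fun h_not => h.notMem_semantics hA h_not hi, h.mem_semantics hA⟩

end IsSolution

end Value

end Semantics

end Game

/-! ### Solutions of composite games -/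

namespace Game

variable {M : ℕ} {u v w v' w' : List Dir}

theorem isTerminating_single (owner₀ : Prop) (p : Priority M) :
    (single v w owner₀ p).IsTerminating :=
  emptyWf.wf

theorem isSolution_single_player0 {p : Priority M} {I : Entry v w → Priority M → Prop}
    {T : Exit v w → Priority M → Prop} (hI : ∀ i k, I i k ↔ ∃ o, T o (max k p)) :
    (single v w True p).IsSolution I (fun _ k => ∃ o, T o (max k p)) T where
  entry i y hy k := by
    rcases y with y | y
    · exact hI i k
    · exact hy.elim
  player0 x _ k := by simp [single]
  player1 x hx := absurd trivial hx

theorem isSolution_single_player1 {p : Priority M} {I : Entry v w → Priority M → Prop}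
    {T : Exit v w → Priority M → Prop} (hI : ∀ i k, I i k ↔ ∀ o, T o (max k p)) :
    (single v w False p).IsSolution I (fun _ k => ∀ o, T o (max k p)) T where
  entry i y hy k := by
    rcases y with y | y
    · exact hI i k
    · exact hy.elim
  player0 x hx := hx.elim
  player1 x _ k := by simp [single]

theorem isTerminating_wires (e : Entry v w ≃ Exit v w) : (wires (M := M) e).IsTerminating :=
  ⟨fun x => x.elim⟩

theorem isSolution_wires {e : Entry v w ≃ Exit v w} {I : Entry v w → Priority M → Prop}
    {T : Exit v w → Priority M → Prop} (hI : ∀ i k, I i k ↔ T (e i) k) :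
    (wires e).IsSolution I (fun x => Empty.elim x) T where
  entry i y hy k := by
    rcases y with y | y
    · exact hy.elim
    · obtain rfl : e i = y := hy
      exact hI i k
  player0 x := x.elim
  player1 x := x.elim

section Image

variable {α β κ : Type*} {E : α → Prop} {E' : β → Prop} {f : α → β} {g : α → κ → Prop}
  {g' : β → κ → Prop}

theorem exists_and_image_iff (hE : ∀ t, E' t ↔ ∃ y, E y ∧ f y = t) (hg : ∀ y, g' (f y) = g y)
    (k : κ) : (∃ t, E' t ∧ g' t k) ↔ ∃ y, E y ∧ g y k := by
  simp [hE, hg]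

theorem forall_imp_image_iff (hE : ∀ t, E' t ↔ ∃ y, E y ∧ f y = t) (hg : ∀ y, g' (f y) = g y)
    (k : κ) : (∀ t, E' t → g' t k) ↔ ∀ y, E y → g y k := by
  simp [hE, hg]

end Image

section Tensor

variable {A : Game M v w} {B : Game M v' w'}

theorem tensorEdge_fst_iff {s : Entry v w ⊕ A.V} {t} :
    TensorEdge A B (Sum.map (fun i => tensorEntry v w v' w' (Sum.inl i)) Sum.inl s) t ↔
      ∃ y, A.E s y ∧ Sum.map Sum.inl (fun o => tensorExit v w v' w' (Sum.inl o)) y = t := by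
  constructor
  · intro h
    generalize hs : (Sum.map (fun i => tensorEntry v w v' w' (Sum.inl i)) Sum.inl s :
      Entry (v ++ v') (w ++ w') ⊕ (A.V ⊕ B.V)) = s' at h
    rcases h with @⟨x, y, h⟩ | @⟨x, y, h⟩
    · obtain rfl : s = x := by rcases s with s | s <;> rcases x with x | x <;> simp_all
      exact ⟨y, h, rfl⟩
    · rcases s with s | s <;> rcases x with x | x <;> simp at hs
  · rintro ⟨y, hy, rfl⟩
    exact .fst hy

theorem tensorEdge_snd_iff {s : Entry v' w' ⊕ B.V} {t} :
    TensorEdge A B (Sum.map (fun i => tensorEntry v w v' w' (Sum.inr i)) Sum.inr s) t ↔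
      ∃ y, B.E s y ∧ Sum.map Sum.inr (fun o => tensorExit v w v' w' (Sum.inr o)) y = t := by
  constructor
  · intro h
    generalize hs : (Sum.map (fun i => tensorEntry v w v' w' (Sum.inr i)) Sum.inr s :
      Entry (v ++ v') (w ++ w') ⊕ (A.V ⊕ B.V)) = s' at h
    rcases h with @⟨x, y, h⟩ | @⟨x, y, h⟩
    · rcases s with s | s <;> rcases x with x | x <;> simp at hs
    · obtain rfl : s = x := by rcases s with s | s <;> rcases x with x | x <;> simp_all
      exact ⟨y, h, rfl⟩
  · rintro ⟨y, hy, rfl⟩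
    exact .snd hy

theorem tensor_edge_inl_iff {x : A.V} {t} : (A.tensor B).E (Sum.inr (Sum.inl x)) t ↔
    ∃ y, A.E (Sum.inr x) y ∧
      Sum.map Sum.inl (fun o => tensorExit v w v' w' (Sum.inl o)) y = t :=
  tensorEdge_fst_iff (s := Sum.inr x)

theorem tensor_edge_inr_iff {x : B.V} {t} : (A.tensor B).E (Sum.inr (Sum.inr x)) t ↔
    ∃ y, B.E (Sum.inr x) y ∧
      Sum.map Sum.inr (fun o => tensorExit v w v' w' (Sum.inr o)) y = t :=
  tensorEdge_snd_iff (s := Sum.inr x)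

theorem IsTerminating.tensor (hA : A.IsTerminating) (hB : B.IsTerminating) :
    (A.tensor B).IsTerminating := by
  refine Subrelation.wf ?_ (Sum.lex_wf hA hB)
  rintro t (x | x) h
  · obtain ⟨y | y, hy, ht⟩ := tensor_edge_inl_iff.1 h
    · obtain rfl := Sum.inl_injective ht
      exact .inl hy
    · cases ht
  · obtain ⟨y | y, hy, ht⟩ := tensor_edge_inr_iff.1 h
    · obtain rfl := Sum.inl_injective ht
      exact .inr hy
    · cases ht

theorem IsSolution.tensor {I : Entry (v ++ v') (w ++ w') → Priority M → Prop}
    {T : Exit (v ++ v') (w ++ w') → Priority M → Prop} {X : A.V → Priority M → Prop}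
    {X' : B.V → Priority M → Prop}
    (hA : A.IsSolution (fun i => I (tensorEntry v w v' w' (Sum.inl i))) X
      fun o => T (tensorExit v w v' w' (Sum.inl o)))
    (hB : B.IsSolution (fun i => I (tensorEntry v w v' w' (Sum.inr i))) X'
      fun o => T (tensorExit v w v' w' (Sum.inr o))) :
    (A.tensor B).IsSolution I (Sum.elim X X') T := by
  have h_inl y : Sum.elim (Sum.elim X X') T
      (Sum.map Sum.inl (fun o => tensorExit v w v' w' (Sum.inl o)) y) =
        Sum.elim X (fun o => T (tensorExit v w v' w' (Sum.inl o))) y := by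
    rcases y with y | y <;> rfl
  have h_inr y : Sum.elim (Sum.elim X X') T
      (Sum.map Sum.inr (fun o => tensorExit v w v' w' (Sum.inr o)) y) =
        Sum.elim X' (fun o => T (tensorExit v w v' w' (Sum.inr o))) y := by
    rcases y with y | y <;> rfl
  refine ⟨fun i t ht k => ?_, ?_, ?_⟩
  · obtain ⟨i | i, rfl⟩ := (tensorEntry v w v' w').surjective i
    · obtain ⟨y, hy, rfl⟩ := (tensorEdge_fst_iff (s := Sum.inl i)).1 ht
      exact (hA.entry i y hy k).trans (iff_of_eq (congrFun (h_inl y) k).symm)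
    · obtain ⟨y, hy, rfl⟩ := (tensorEdge_snd_iff (s := Sum.inl i)).1 ht
      exact (hB.entry i y hy k).trans (iff_of_eq (congrFun (h_inr y) k).symm)
  · rintro (x | x) hx k
    · exact (hA.player0 x hx k).trans
        (exists_and_image_iff (fun _ => tensor_edge_inl_iff) h_inl _).symm
    · exact (hB.player0 x hx k).trans
        (exists_and_image_iff (fun _ => tensor_edge_inr_iff) h_inr _).symm
  · rintro (x | x) hx k
    · exact (hA.player1 x hx k).trans
        (forall_imp_image_iff (fun _ => tensor_edge_inl_iff) h_inl _).symm
    · exact (hB.player1 x hx k).trans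
        (forall_imp_image_iff (fun _ => tensor_edge_inr_iff) h_inr _).symm

end Tensor

section Comp

variable {A : Game M u v} {B : Game M v w}

theorem glue_srcFst_iff {s : Entry u v ⊕ A.V} {t} :
    Glue A B (srcFst B.V w s) t ↔ ∃ y, A.E s y ∧ tgtFst B.V w y = t := by
  constructor
  · intro h
    generalize hs : srcFst B.V w s = s' at h
    rcases h with @⟨x, y, h⟩ | @⟨x, y, h⟩
    · obtain rfl : s = x := by
        rcases s with (s | s) | s <;> rcases x with (x | x) | x <;> simp_all [srcFst]
      exact ⟨y, h, rfl⟩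
    · rcases s with (s | s) | s <;> rcases x with (x | x) | x <;> simp [srcFst, srcSnd] at hs
  · rintro ⟨y, hy, rfl⟩
    exact .fst hy

theorem glue_srcSnd_iff {s : Entry v w ⊕ B.V} {t} :
    Glue A B (srcSnd A.V u s) t ↔ ∃ y, B.E s y ∧ tgtSnd A.V u y = t := by
  constructor
  · intro h
    generalize hs : srcSnd A.V u s = s' at h
    rcases h with @⟨x, y, h⟩ | @⟨x, y, h⟩
    · rcases s with (s | s) | s <;> rcases x with (x | x) | x <;> simp [srcFst, srcSnd] at hs
    · obtain rfl : s = x := by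
        rcases s with (s | s) | s <;> rcases x with (x | x) | x <;> simp_all [srcSnd]
      exact ⟨y, h, rfl⟩
  · rintro ⟨y, hy, rfl⟩
    exact .snd hy

variable [IsEmpty (Port v .left)]

/-- The targets of edges of the second game, as targets of edges of a composition whose middle
wires are all directed to the right. -/
def compTgtSnd {X Y : Type} : Y ⊕ Exit v w → (X ⊕ Y) ⊕ Exit u w :=
  Sum.map Sum.inr (Sum.elim isEmptyElim Sum.inr)

theorem compTgtSnd_ne_inl_inl {X Y : Type} (y : Y ⊕ Exit v w) (x : X) :
    compTgtSnd (u := u) y ≠ Sum.inl (Sum.inl x) := by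
  rcases y with y | y | y
  exacts [nofun, isEmptyElim y, nofun]

/-- The targets of edges of the first game, as targets of edges of a composition whose middle
wires are all directed to the right: an exit in the middle is replaced by the target of the edge
by which the second game continues. -/
noncomputable def compTgtFst (B : Game M v w) {X : Type} :
    X ⊕ Exit u v → (X ⊕ B.V) ⊕ Exit u w :=
  Sum.elim (Sum.inl ∘ Sum.inl)
    (Sum.elim (Sum.inr ∘ Sum.inl) fun p => compTgtSnd (B.entryNext (Sum.inl p)))

theorem through_srcSnd_iff {s : Entry v w ⊕ B.V} {t} :
    Through (Glue A B) (srcSnd A.V u s) t ↔ ∃ y, B.E s y ∧ compTgtSnd y = t := by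
  have h_tgt : ∀ y : B.V ⊕ Exit v w, tgtSnd A.V u y = Sum.inr (compTgtSnd y) := by
    rintro (y | y | y)
    exacts [rfl, isEmptyElim y, rfl]
  constructor
  · rintro (h | h)
    · obtain ⟨y, hy, ht⟩ := glue_srcSnd_iff.1 h
      exact ⟨y, hy, Sum.inr_injective ((h_tgt y).symm.trans ht)⟩
    · obtain ⟨y, -, ht⟩ := glue_srcSnd_iff.1 h
      cases (h_tgt y).symm.trans ht
  · rintro ⟨y, hy, rfl⟩
    exact .last (glue_srcSnd_iff.2 ⟨y, hy, h_tgt y⟩)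

theorem through_mid_iff {p : Port v .right} {t} :
    Through (Glue A B) (Sum.inr (Sum.inl p)) t ↔ compTgtSnd (B.entryNext (Sum.inl p)) = t := by
  refine (through_srcSnd_iff (s := Sum.inl (Sum.inl p))).trans ⟨?_, fun ht => ?_⟩
  · rintro ⟨y, hy, rfl⟩
    rw [(B.entry_unique _).unique (entryNext_edge _) hy]
  · exact ⟨_, entryNext_edge _, ht⟩

theorem through_srcFst_iff {s : Entry u v ⊕ A.V} {t} :
    Through (Glue A B) (srcFst B.V w s) t ↔ ∃ y, A.E s y ∧ compTgtFst B y = t := by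
  constructor
  · rintro (h | ⟨h, h_mid⟩)
    · obtain ⟨y | y | y, hy, ht⟩ := glue_srcFst_iff.1 h
      · exact ⟨_, hy, Sum.inr_injective ht⟩
      · exact ⟨_, hy, Sum.inr_injective ht⟩
      · cases ht
    · obtain ⟨y | y | p, hy, ht⟩ := glue_srcFst_iff.1 h
      · cases ht
      · cases ht
      · obtain rfl := Sum.inl_injective ht
        exact ⟨_, hy, through_mid_iff.1 h_mid⟩
  · rintro ⟨y | y | p, hy, rfl⟩
    · exact .last (.fst hy)
    · exact .last (.fst hy)
    · exact .step (.fst hy) (through_mid_iff.2 rfl)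

theorem comp_edge_inl_iff {x : A.V} {t} : (A.comp B).E (Sum.inr (Sum.inl x)) t ↔
    ∃ y, A.E (Sum.inr x) y ∧ compTgtFst B y = t :=
  through_srcFst_iff (s := Sum.inr x)

theorem comp_edge_inr_iff {x : B.V} {t} : (A.comp B).E (Sum.inr (Sum.inr x)) t ↔
    ∃ y, B.E (Sum.inr x) y ∧ compTgtSnd y = t :=
  through_srcSnd_iff (s := Sum.inr x)

theorem IsTerminating.comp (hA : A.IsTerminating) (hB : B.IsTerminating) :
    (A.comp B).IsTerminating := by
  refine Subrelation.wf ?_ (InvImage.wf Sum.swap (Sum.lex_wf hB hA))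
  rintro (t | t) (x | x) h
  · obtain ⟨y | y | p, hy, ht⟩ := comp_edge_inl_iff.1 h
    · obtain rfl := Sum.inl_injective (Sum.inl_injective ht)
      exact .inr hy
    · cases ht
    · exact absurd ht (compTgtSnd_ne_inl_inl _ t)
  · obtain ⟨y, -, ht⟩ := comp_edge_inr_iff.1 h
    exact absurd ht (compTgtSnd_ne_inl_inl y t)
  · exact .sep _ _
  · obtain ⟨y | y, hy, ht⟩ := comp_edge_inr_iff.1 h
    · obtain rfl := Sum.inr_injective (Sum.inl_injective ht)
      exact .inl hy
    · rcases y with y | y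
      · exact isEmptyElim y
      · cases ht

theorem IsSolution.comp {I : Entry u v → Priority M → Prop} {T : Exit u v → Priority M → Prop}
    {I' : Entry v w → Priority M → Prop} {T' : Exit v w → Priority M → Prop}
    {X : A.V → Priority M → Prop} {X' : B.V → Priority M → Prop}
    (hA : A.IsSolution I X T) (hB : B.IsSolution I' X' T')
    (h_mid : ∀ p, T (Sum.inr p) = I' (Sum.inl p)) :
    (A.comp B).IsSolution (Sum.elim (fun p => I (Sum.inl p)) fun p => I' (Sum.inr p))
      (Sum.elim X X') (Sum.elim (fun p => T (Sum.inl p)) fun p => T' (Sum.inr p)) := by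
  have h_snd : ∀ y, Sum.elim (Sum.elim X X')
      (Sum.elim (fun p => T (Sum.inl p)) fun p => T' (Sum.inr p)) (compTgtSnd y) =
        Sum.elim X' T' y := by
    rintro (y | y | y)
    exacts [rfl, isEmptyElim y, rfl]
  have h_fst : ∀ y, Sum.elim (Sum.elim X X')
      (Sum.elim (fun p => T (Sum.inl p)) fun p => T' (Sum.inr p)) (compTgtFst B y) =
        Sum.elim X T y := by
    rintro (y | y | p)
    · rfl
    · rfl
    · refine (h_snd _).trans (funext fun k => propext ?_)
      rw [Sum.elim_inr, h_mid, hB.entry _ _ (entryNext_edge _) k]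
  refine ⟨?_, ?_, ?_⟩
  · rintro (p | p) t ht k
    · obtain ⟨y, hy, rfl⟩ := (through_srcFst_iff (s := Sum.inl (Sum.inl p))).1 ht
      exact (hA.entry _ y hy k).trans (iff_of_eq (congrFun (h_fst y) k).symm)
    · obtain ⟨y, hy, rfl⟩ := (through_srcSnd_iff (s := Sum.inl (Sum.inr p))).1 ht
      exact (hB.entry _ y hy k).trans (iff_of_eq (congrFun (h_snd y) k).symm)
  · rintro (x | x) hx k
    · exact (hA.player0 x hx k).trans
        (exists_and_image_iff (fun _ => comp_edge_inl_iff) h_fst _).symm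
    · exact (hB.player0 x hx k).trans
        (exists_and_image_iff (fun _ => comp_edge_inr_iff) h_snd _).symm
  · rintro (x | x) hx k
    · exact (hA.player1 x hx k).trans
        (forall_imp_image_iff (fun _ => comp_edge_inl_iff) h_fst _).symm
    · exact (hB.player1 x hx k).trans
        (forall_imp_image_iff (fun _ => comp_edge_inr_iff) h_snd _).symm

end Comp

end Game

/-! ### The games of acyclic diagrams -/

section AcyclicGames

variable {M : ℕ} {v w : List Dir}

theorem Port.isEmpty_left (hv : .left ∉ v) : IsEmpty (Port v .left) :=
  ⟨fun p => hv (p.2 ▸ List.get_mem v p.1)⟩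

theorem get_eq_right (hv : .left ∉ v) (j : Fin v.length) : v.get j = .right := by
  have := List.get_mem v j
  rcases h : v.get j
  · rfl
  · exact absurd (h ▸ this) hv

/-- The valuation of the entries of a game given by values of the wires on the left; it is meant
for games all of whose wires on the right are directed to the right. -/
def entryVal (v w : List Dir) (x : ℕ → Priority M → Prop) : Entry v w → Priority M → Prop :=
  Sum.elim (fun p => x p.1.val) fun _ _ => False

/-- The valuation of the exits of a game given by values of the wires on the right; it is meant
for games all of whose wires on the left are directed to the right. -/
def exitVal (v w : List Dir) (x : ℕ → Priority M → Prop) : Exit v w → Priority M → Prop :=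
  Sum.elim (fun _ _ => False) fun p => x p.1.val

variable {x f : ℕ → Priority M → Prop} {p : Priority M}

theorem exists_exitVal_iff (hw : .left ∉ w) (k : Priority M) :
    (∃ o : Exit v w, exitVal v w x o k) ↔ ∃ j < w.length, x j k := by
  constructor
  · rintro ⟨o | o, h⟩
    · exact h.elim
    · exact ⟨_, o.1.2, h⟩
  · exact fun ⟨j, hj, h⟩ => ⟨Sum.inr ⟨⟨j, hj⟩, get_eq_right hw _⟩, h⟩

theorem forall_exitVal_iff (hv : .left ∉ v) (hw : .left ∉ w) (k : Priority M) :
    (∀ o : Exit v w, exitVal v w x o k) ↔ ∀ j < w.length, x j k := by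
  have := Port.isEmpty_left hv
  constructor
  · exact fun h j hj => h (Sum.inr ⟨⟨j, hj⟩, get_eq_right hw _⟩)
  · rintro h (o | o)
    · exact isEmptyElim o
    · exact h _ o.1.2

theorem Game.isSolution_single_player0_entryVal (hw : .left ∉ w)
    (hf : ∀ i < v.length, ∀ k, f i k ↔ ∃ j < w.length, x j (max k p)) :
    (Game.single v w True p).IsSolution (entryVal v w f)
      (fun _ k => ∃ o, exitVal v w x o (max k p)) (exitVal v w x) := by
  have := Port.isEmpty_left hw
  refine Game.isSolution_single_player0 ?_
  rintro (i | i) k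
  · exact (hf i.1 i.1.2 k).trans (exists_exitVal_iff hw _).symm
  · exact isEmptyElim i

theorem Game.isSolution_single_player1_entryVal (hv : .left ∉ v) (hw : .left ∉ w)
    (hf : ∀ i < v.length, ∀ k, f i k ↔ ∀ j < w.length, x j (max k p)) :
    (Game.single v w False p).IsSolution (entryVal v w f)
      (fun _ k => ∀ o, exitVal v w x o (max k p)) (exitVal v w x) := by
  have := Port.isEmpty_left hw
  refine Game.isSolution_single_player1 ?_
  rintro (i | i) k
  · exact (hf i.1 i.1.2 k).trans (forall_exitVal_iff hv hw _).symm
  · exact isEmptyElim i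

theorem Gen.isTerminating_toGame (g : Gen M v w) : g.toGame.IsTerminating := by
  cases g with
  | cap | cup => exact ⟨fun x => x.elim⟩
  | _ => exact Game.isTerminating_single _ _

theorem Gen.exists_isSolution_toGame {g : Gen M v w} (hg : (Diagram.gen g).IsAcyclic)
    (x : ℕ → Priority M → Prop) :
    ∃ X, g.toGame.IsSolution (entryVal v w (g.interp x)) X (exitVal v w x) := by
  cases g with
  | player0 | lose0 =>
    refine ⟨_, Game.isSolution_single_player0_entryVal (by simp) ?_⟩
    simp [interp, Nat.le_one_iff_eq_zero_or_eq_one, or_and_right, exists_or]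
  | player1 | lose1 | merge | start =>
    refine ⟨_, Game.isSolution_single_player1_entryVal (by simp) (by simp) ?_⟩
    simp [interp, Nat.le_one_iff_eq_zero_or_eq_one]
  | prio p =>
    refine ⟨_, Game.isSolution_single_player1_entryVal (by simp) (by simp) ?_⟩
    simp [interp, PriorityLattice.act]
  | cap => exact absurd hg not_isAcyclic_cap
  | cup => exact absurd hg not_isAcyclic_cup

theorem Diagram.isTerminating_toGame {c : Diagram M v w} (hc : c.IsAcyclic) (hv : .left ∉ v) :
    c.toGame.IsTerminating := by
  induction c with
  | gen g => exact g.isTerminating_toGame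
  | id | swap => exact Game.isTerminating_wires _
  | comp c d ihc ihd =>
    have hw := IsAcyclic.left_notMem hc.1 hv
    have := Port.isEmpty_left hw
    exact (ihc hc.1 hv).comp (ihd hc.2 hw)
  | tensor c d ihc ihd =>
    obtain ⟨hv, hv'⟩ := not_or.1 (mt List.mem_append.2 hv)
    exact (ihc hc.1 hv).tensor (ihd hc.2 hv')

theorem Port.swap_val (v w : List Dir) {a : Dir} (p : Port (v ++ w) a) :
    (Port.swap v w a p).1.val =
      if p.1.val < v.length then w.length + p.1.val else p.1.val - v.length := by
  obtain ⟨q, rfl⟩ := (Port.append v w a).surjective p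
  have h_swap : Port.swap v w a (Port.append v w a q) = Port.append w v a q.swap := by
    simp [Port.swap]
  rw [h_swap]
  rcases q with q | q <;> simp [Port.append, Port.inl, Port.inr]

section Tensor

variable {v' w' : List Dir}

theorem entryVal_tensorEntry_inl (hw : .left ∉ w) {c : Diagram M v w} {d : Diagram M v' w'} :
    (fun i => entryVal _ _ ((c.tensor d).interp x) (Game.tensorEntry v w v' w' (Sum.inl i))) =
      entryVal v w (c.interp x) := by
  have := Port.isEmpty_left hw
  funext i
  rcases i with i | i
  · simp [entryVal, Game.tensorEntry, Port.append, Port.inl, Diagram.interp]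
  · exact isEmptyElim i

theorem entryVal_tensorEntry_inr (hw' : .left ∉ w') {c : Diagram M v w} {d : Diagram M v' w'} :
    (fun i => entryVal _ _ ((c.tensor d).interp x) (Game.tensorEntry v w v' w' (Sum.inr i))) =
      entryVal v' w' (d.interp fun j => x (w.length + j)) := by
  have := Port.isEmpty_left hw'
  funext i
  rcases i with i | i
  · simp [entryVal, Game.tensorEntry, Port.append, Port.inr, Diagram.interp]
  · exact isEmptyElim i

theorem exitVal_tensorExit_inl :
    (fun o => exitVal _ _ x (Game.tensorExit v w v' w' (Sum.inl o))) = exitVal v w x := by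
  funext o
  rcases o with o | o <;> simp [exitVal, Game.tensorExit, Port.append, Port.inl]

theorem exitVal_tensorExit_inr :
    (fun o => exitVal _ _ x (Game.tensorExit v w v' w' (Sum.inr o))) =
      exitVal v' w' fun j => x (w.length + j) := by
  funext o
  rcases o with o | o <;> simp [exitVal, Game.tensorExit, Port.append, Port.inr]

end Tensor

theorem Diagram.exists_isSolution_toGame {c : Diagram M v w} (hc : c.IsAcyclic)
    (hv : .left ∉ v) (x : ℕ → Priority M → Prop) :
    ∃ X, c.toGame.IsSolution (entryVal v w (c.interp x)) X (exitVal v w x) := by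
  induction c generalizing x with
  | gen g => exact Gen.exists_isSolution_toGame hc x
  | id v =>
    have := Port.isEmpty_left hv
    refine ⟨_, Game.isSolution_wires ?_⟩
    rintro (p | p) k
    · exact .rfl
    · exact isEmptyElim p
  | swap v w =>
    have := Port.isEmpty_left (hc.left_notMem hv)
    refine ⟨_, Game.isSolution_wires ?_⟩
    rintro (p | p) k
    · change _ ↔ x (Port.swap v w .right p).1.val k
      rw [Port.swap_val]
      simp only [entryVal, Sum.elim_inl, interp]
      split <;> rfl
    · exact isEmptyElim p
  | comp c d ihc ihd =>
    have hw := IsAcyclic.left_notMem hc.1 hv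
    have := Port.isEmpty_left hw
    obtain ⟨X', hX'⟩ := ihd hc.2 hw x
    obtain ⟨X, hX⟩ := ihc hc.1 hv (d.interp x)
    exact ⟨_, hX.comp hX' fun _ => rfl⟩
  | tensor c d ihc ihd =>
    obtain ⟨hv, hv'⟩ := not_or.1 (mt List.mem_append.2 hv)
    have hw := IsAcyclic.left_notMem hc.1 hv
    have hw' := IsAcyclic.left_notMem hc.2 hv'
    obtain ⟨X, hX⟩ := ihc hc.1 hv x
    obtain ⟨X', hX'⟩ := ihd hc.2 hv' fun j => x (_ + j)
    refine ⟨_, Game.IsSolution.tensor (X := X) (X' := X') ?_ ?_⟩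
    · rwa [entryVal_tensorEntry_inl hw, exitVal_tensorExit_inl]
    · rwa [entryVal_tensorEntry_inr hw', exitVal_tensorExit_inr]

theorem Diagram.mem_semantics_toGame_iff {c : Diagram M v w} (hc : c.IsAcyclic) (hv : .left ∉ v)
    (x : ℕ → Priority M → Prop) (i : Port v .right) :
    ({e | exitVal v w x e.1 e.2}, Sum.inl i) ∈ c.toGame.semantics ↔ c.interp x i.1 0 := by
  obtain ⟨X, hX⟩ := exists_isSolution_toGame hc hv x
  exact hX.mem_semantics_iff (isTerminating_toGame hc hv) _

end AcyclicGames

end ParityGame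

theorem mainTheorem5_general (M m n : ℕ)
    (c d : ParityGame.Diagram M (ParityGame.rightWires m) (ParityGame.rightWires n))
    (hc : c.IsAcyclic) (hd : d.IsAcyclic) (h : c.toGame.Equivalent d.toGame) :
    ParityGame.PGAEq c d := by
  open ParityGame in
  refine PGAEq.of_interp hc hd fun T i hi => ?_
  let entry : Port (rightWires m) .right := ⟨⟨i, by simpa using hi⟩, by simp⟩
  have h_semantics : c.toGame.semantics = d.toGame.semantics := h
  calc c.interp T i 0
    _ ↔ ({e | exitVal _ _ T e.1 e.2}, Sum.inl entry) ∈ c.toGame.semantics :=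
      (Diagram.mem_semantics_toGame_iff hc (left_notMem_rightWires m) T entry).symm
    _ ↔ ({e | exitVal _ _ T e.1 e.2}, Sum.inl entry) ∈ d.toGame.semantics := by rw [h_semantics]
    _ ↔ d.interp T i 0 :=
      Diagram.mem_semantics_toGame_iff hd (left_notMem_rightWires m) T entry

theorem mainTheorem5 (M : ℕ) (hM : 2 ≤ M) (m n : ℕ)
    (c d : ParityGame.Diagram M (ParityGame.rightWires m) (ParityGame.rightWires n))
    (hc : c.IsAcyclic) (hd : d.IsAcyclic) (hc' : c.IsNormalForm) (hd' : d.IsNormalForm)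
    (h : c.toGame.Equivalent d.toGame) :
    ParityGame.PGAEq c d :=
  mainTheorem5_general M m n c d hc hd h
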